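/- There is an absolute constant $M$ with the following property. Let $n_k\in\mathbb N$, $n_k\ge 1$, and $r_k\in[0,1)$ $(k\ge 1)$ satisfy $r_k\to 1$ as $k\to\infty$ and $n_k(1-r_k)\ge M$ for every $k$. Put $\lambda_{k,j}=r_k e^{2\pi i j/n_k}$ for $k\ge 1$, $0\le j\le n_k-1$, let $\lambda_1,\lambda_2,\dots$ be the sequence of these points listed in the alphabetical (lexicographic) order of the pairs $(k,j)$, that is $\lambda_{1,0},\dots,\lambda_{1,n_1-1},\lambda_{2,0},\dots$ (with repetitions if points coincide), and let $k_\lambda(z)=\frac{1}{1-\bar\lambda z}$ be the Cauchy kernel at $\lambda$. For $1<p<\infty$ let $H^p$ be the Hardy space of all functions $f$ analytic in the unit disk with $\|f\|_{H^p}^p=\sup_{0<r<1}\frac1{2\pi}\int_0^{2\pi}|f(re^{i\theta})|^p\,d\theta<\infty$. Then for every $p\in(1,\infty)$ the sequence $(k_{\lambda_m})_{m\ge1}$ is a representing system for $H^p$: all $k_{\lambda_m}$ belong to $H^p$, and for every $f\in H^p$ there are complex numbers $c_1,c_2,\dots$ such that $\big\|f-\sum_{m=1}^{N}c_m k_{\lambda_m}\big\|_{H^p}\to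 0$ as $N\to\infty$. -/

import Mathlib

open MeasureTheory Filter Topology
open scoped ENNReal

noncomputable section

/-- Normalized Lebesgue measure on the unit circle, in the angular coordinate `θ ∈ (0, 2π]`. -/
def circleMeasure : Measure ℝ :=
  (ENNReal.ofReal (2 * Real.pi))⁻¹ • (volume.restrict (Set.Ioc 0 (2 * Real.pi)))

/-- The Hardy norm `sup_{0 < r < 1} (∫ |f(r ζ)|^p dm(ζ))^{1/p}`, with values in `[0, ∞]`. -/
def hardyNorm (p : ℝ≥0∞) (f : ℂ → ℂ) : ℝ≥0∞ :=
  ⨆ r ∈ Set.Ioo (0 : ℝ) 1, eLpNorm (fun θ : ℝ => f (circleMap 0 r θ)) p circleMeasure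

/-- `f` belongs to `H^p` of the unit disk: it is analytic in the open disk and has finite Hardy
norm. The values of `f` outside the open disk play no role. -/
def MemHardy (p : ℝ≥0∞) (f : ℂ → ℂ) : Prop :=
  DifferentiableOn ℂ f (Metric.ball 0 1) ∧ hardyNorm p f < ∞

/-- The sequence `x` of functions is a representing system for `H^p`: it lies in `H^p`, and every
`f` in `H^p` is the sum, in the norm of `H^p`, of a series `∑ c m • x m` taken in the order
of the indices. -/
def IsRepresentingHardy (p : ℝ≥0∞) (x : ℕ → ℂ → ℂ) : Prop :=
  (∀ m, MemHardy p (x m)) ∧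
    ∀ f, MemHardy p f → ∃ c : ℕ → ℂ,
      Tendsto (fun N : ℕ => hardyNorm p (fun z => f z - ∑ m ∈ Finset.range N, c m * x m z))
        atTop (𝓝 0)

/-- The Cauchy kernel at `w`. -/
def cauchyKernel (w z : ℂ) : ℂ := 1 / (1 - (starRingEnd ℂ) w * z)

/-- Number of points in the layers before layer `k`, when layer `i` has `n i` points. -/
def layerStart (n : ℕ → ℕ) (k : ℕ) : ℕ := ∑ i ∈ Finset.range k, n i

/-- In the alphabetical order of the pairs `(k, j)`, `j < n k`, the first entry of the pair number
`m` (counted from `0`, with all `n k ≥ 1`). -/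
def alphaLayer (n : ℕ → ℕ) (m : ℕ) : ℕ := Nat.findGreatest (fun k => layerStart n k ≤ m) m

/-- The second entry of the pair number `m` in the alphabetical order. -/
def alphaIndex (n : ℕ → ℕ) (m : ℕ) : ℕ := m - layerStart n (alphaLayer n m)

/-- The pair `(k, j)` is number `n 0 + ⋯ + n (k - 1) + j` in the alphabetical order. -/
theorem alpha_layerStart_add (n : ℕ → ℕ) (hn : ∀ k, 1 ≤ n k) (k j : ℕ) (hj : j < n k) :
    alphaLayer n (layerStart n k + j) = k ∧ alphaIndex n (layerStart n k + j) = j := by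
  have hk : ∀ k, k ≤ layerStart n k := by
    intro k
    induction k with
    | zero => simp
    | succ k ih =>
      have := hn k
      simp only [layerStart, Finset.sum_range_succ] at *
      omega
  have h : alphaLayer n (layerStart n k + j) = k := by
    rw [alphaLayer, Nat.findGreatest_eq_iff]
    refine ⟨(hk k).trans (Nat.le_add_right _ _), fun _ => Nat.le_add_right _ _, ?_⟩
    intro l hl _ hle
    have h1 : layerStart n (k + 1) ≤ layerStart n l :=
      Finset.sum_le_sum_of_subset (Finset.range_mono hl)
    have h2 : layerStart n (k + 1) = layerStart n k + n k := Finset.sum_range_succ _ _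
    omega
  exact ⟨h, by rw [alphaIndex, h]; omega⟩

/-- The point `r_k e^{2πij/n_k}`. -/
def layerPoint (r : ℕ → ℝ) (n : ℕ → ℕ) (k j : ℕ) : ℂ :=
  (r k : ℂ) * Complex.exp (2 * Real.pi * Complex.I * j / n k)

/-- The points `r_k e^{2πij/n_k}`, `0 ≤ j < n_k`, listed in the alphabetical order of `(k, j)`. -/
def alphaPoint (r : ℕ → ℝ) (n : ℕ → ℕ) (m : ℕ) : ℂ :=
  layerPoint r n (alphaLayer n m) (alphaIndex n m)

end

/-! The constant is `M = 2`. If `g` is a polynomial of degree below `n_k`, the combination of the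
kernels of layer `k` with coefficients `g(ω^j) / n_k`, `ω = e^{2πi/n_k}`, equals `g(r_k z) / (1 -
(r_k z)^{n_k})` (`layerSum_polynomial`). As `r_k^{n_k} ≤ e^{-2} ≤ 1/3`, this differs from `g` by
about half of `‖g‖` at most, once `k` is so large that `g(r_k z)` is close to `g(z)`. Polynomials
are dense in `H^p`, so any remainder can be shrunk by a fixed factor using a single remote layer.

What remains is to control the partial sums that stop inside a layer. A part of a layer is not
bounded by `‖g‖`, but it is bounded by `C max |g|` over the unit circle, with `C` depending on `p`
only (`exists_hardyNorm_layerSum_le`). Indeed the kernels have nonnegative real part, so passing to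
coefficients in `[0, 1/n_k]` keeps the real part between `0` and that of the full sum `1 / (1 - (r_k
z)^{n_k})`; an analytic function with bounded real part, real at the origin, is bounded in `H^p` for
finite `p`. The correction is then spread over `L` consecutive layers with weight `1/L` each: the
total gain is unchanged, while an incomplete layer costs only `C max |g| / L`, which is small
against `‖g‖` for large `L` (`exists_layers_approximation`). Iteration gives remainders decaying
like `(7/8)^s`, with all intermediate partial sums under control.

Density of the polynomials is obtained without boundary values, from the monotonicity of the circle
means and uniform convexity (`MemHardy.exists_dilation`). -/

/-! ### Circle means and the Hardy norm -/

/-- The `L^p` mean of `f` over the circle of radius `t`. -/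
noncomputable def circleLpNorm (p : ℝ≥0∞) (f : ℂ → ℂ) (t : ℝ) : ℝ≥0∞ :=
  eLpNorm (fun θ : ℝ => f (circleMap 0 t θ)) p circleMeasure

instance isProbabilityMeasure_circleMeasure : IsProbabilityMeasure circleMeasure := by
  constructor
  have h : ENNReal.ofReal (2 * Real.pi) ≠ 0 := by
    simpa using Real.pi_pos
  simp only [circleMeasure, Measure.smul_apply, Measure.restrict_apply_univ, Real.volume_Ioc,
    sub_zero, smul_eq_mul]
  exact ENNReal.inv_mul_cancel h ENNReal.ofReal_ne_top

theorem integral_circleMeasure {E : Type*} [NormedAddCommGroup E] [NormedSpace ℝ E]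
    (f : ℂ → E) (t : ℝ) :
    ∫ θ, f (circleMap 0 t θ) ∂circleMeasure = Real.circleAverage f 0 t := by
  rw [circleMeasure, integral_smul_measure, Real.circleAverage_def,
    intervalIntegral.integral_of_le Real.two_pi_pos.le, ENNReal.toReal_inv,
    ENNReal.toReal_ofReal Real.two_pi_pos.le]

theorem hardyNorm_eq_iSup (p : ℝ≥0∞) (f : ℂ → ℂ) :
    hardyNorm p f = ⨆ t ∈ Set.Ioo (0 : ℝ) 1, circleLpNorm p f t := rfl

theorem circleLpNorm_le_hardyNorm (p : ℝ≥0∞) (f : ℂ → ℂ) {t : ℝ} (ht : t ∈ Set.Ioo (0 : ℝ) 1) :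
    circleLpNorm p f t ≤ hardyNorm p f :=
  le_iSup₂ (f := fun t (_ : t ∈ Set.Ioo (0 : ℝ) 1) => circleLpNorm p f t) t ht

theorem circleMap_mem_unitBall {t : ℝ} (ht : t ∈ Set.Ioo (0 : ℝ) 1) (θ : ℝ) :
    circleMap 0 t θ ∈ Metric.ball (0 : ℂ) 1 := by
  simp [abs_of_pos ht.1, ht.2]

theorem sphere_subset_unitBall {t : ℝ} (ht : t ∈ Set.Ioo (0 : ℝ) 1) :
    Metric.sphere (0 : ℂ) |t| ⊆ Metric.ball 0 1 := by
  rw [abs_of_pos ht.1]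
  exact Metric.sphere_subset_ball ht.2

theorem continuous_comp_circleMap {E : Type*} [TopologicalSpace E] {f : ℂ → E} {t : ℝ}
    (hf : ContinuousOn f (Metric.sphere 0 |t|)) :
    Continuous fun θ : ℝ => f (circleMap 0 t θ) :=
  hf.comp_continuous (continuous_circleMap 0 t) (circleMap_mem_sphere' 0 t)

theorem aestronglyMeasurable_comp_circleMap {f : ℂ → ℂ} {t : ℝ}
    (hf : ContinuousOn f (Metric.sphere 0 |t|)) :
    AEStronglyMeasurable (fun θ : ℝ => f (circleMap 0 t θ)) circleMeasure :=
  (continuous_comp_circleMap hf).aestronglyMeasurable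

theorem memLp_comp_circleMap {f : ℂ → ℂ} {t : ℝ} (p : ℝ≥0∞)
    (hf : ContinuousOn f (Metric.sphere 0 |t|)) :
    MemLp (fun θ : ℝ => f (circleMap 0 t θ)) p circleMeasure := by
  obtain ⟨C, hC⟩ := (isCompact_sphere (0 : ℂ) |t|).exists_bound_of_continuousOn hf
  exact MemLp.of_bound (aestronglyMeasurable_comp_circleMap hf) C
    (Eventually.of_forall fun θ => hC _ (circleMap_mem_sphere' 0 t θ))

theorem circleLpNorm_eq_ofReal {f : ℂ → ℂ} {t : ℝ} {p : ℝ≥0∞} (hp0 : p ≠ 0) (hp : p ≠ ∞)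
    (hf : ContinuousOn f (Metric.sphere 0 |t|)) :
    circleLpNorm p f t =
      ENNReal.ofReal (Real.circleAverage (fun z => ‖f z‖ ^ p.toReal) 0 t ^ p.toReal⁻¹) := by
  rw [circleLpNorm, (memLp_comp_circleMap p hf).eLpNorm_eq_integral_rpow_norm hp0 hp,
    ← integral_circleMeasure]

theorem circleAverage_rpow_nonneg (f : ℂ → ℂ) (q t : ℝ) :
    0 ≤ Real.circleAverage (fun z => ‖f z‖ ^ q) 0 t :=
  Real.circleAverage_nonneg_of_nonneg fun _ _ => by positivity

theorem circleLpNorm_le_ofReal_iff {f : ℂ → ℂ} {t : ℝ} {p : ℝ≥0∞} (hp0 : p ≠ 0) (hp : p ≠ ∞)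
    (hf : ContinuousOn f (Metric.sphere 0 |t|)) {A : ℝ} (hA : 0 ≤ A) :
    circleLpNorm p f t ≤ ENNReal.ofReal A ↔
      Real.circleAverage (fun z => ‖f z‖ ^ p.toReal) 0 t ≤ A ^ p.toReal := by
  rw [circleLpNorm_eq_ofReal hp0 hp hf, ENNReal.ofReal_le_ofReal_iff hA]
  exact Real.rpow_inv_le_iff_of_pos (circleAverage_rpow_nonneg f _ t) hA
    (ENNReal.toReal_pos hp0 hp)

theorem circleLpNorm_add_le {f g : ℂ → ℂ} {t : ℝ} {p : ℝ≥0∞} (hp : 1 ≤ p)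
    (hf : ContinuousOn f (Metric.sphere 0 |t|)) (hg : ContinuousOn g (Metric.sphere 0 |t|)) :
    circleLpNorm p (fun z => f z + g z) t ≤ circleLpNorm p f t + circleLpNorm p g t :=
  eLpNorm_add_le (aestronglyMeasurable_comp_circleMap hf)
    (aestronglyMeasurable_comp_circleMap hg) hp

theorem circleLpNorm_le_of_forall_norm_le {f : ℂ → ℂ} {t B : ℝ} (p : ℝ≥0∞)
    (h : ∀ z ∈ Metric.sphere (0 : ℂ) |t|, ‖f z‖ ≤ B) :
    circleLpNorm p f t ≤ ENNReal.ofReal B := by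
  refine (eLpNorm_le_of_ae_bound (C := B)
    (Eventually.of_forall fun θ => h _ (circleMap_mem_sphere' 0 t θ))).trans ?_
  simp

theorem hardyNorm_mono {f g : ℂ → ℂ} (p : ℝ≥0∞)
    (h : ∀ z ∈ Metric.ball (0 : ℂ) 1, ‖f z‖ ≤ ‖g z‖) : hardyNorm p f ≤ hardyNorm p g :=
  iSup₂_mono fun _ ht => eLpNorm_mono fun θ => h _ (circleMap_mem_unitBall ht θ)

theorem hardyNorm_congr {f g : ℂ → ℂ} (p : ℝ≥0∞)
    (h : ∀ z ∈ Metric.ball (0 : ℂ) 1, f z = g z) : hardyNorm p f = hardyNorm p g :=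
  le_antisymm (hardyNorm_mono p fun z hz => (congrArg norm (h z hz)).le)
    (hardyNorm_mono p fun z hz => (congrArg norm (h z hz)).ge)

theorem hardyNorm_le_of_forall_norm_le {f : ℂ → ℂ} {B : ℝ} (p : ℝ≥0∞)
    (h : ∀ z ∈ Metric.ball (0 : ℂ) 1, ‖f z‖ ≤ B) : hardyNorm p f ≤ ENNReal.ofReal B :=
  iSup₂_le fun _ ht => circleLpNorm_le_of_forall_norm_le p fun z hz =>
    h z (sphere_subset_unitBall ht hz)

theorem hardyNorm_add_le {f g : ℂ → ℂ} {p : ℝ≥0∞} (hp : 1 ≤ p)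
    (hf : DifferentiableOn ℂ f (Metric.ball 0 1)) (hg : DifferentiableOn ℂ g (Metric.ball 0 1)) :
    hardyNorm p (fun z => f z + g z) ≤ hardyNorm p f + hardyNorm p g :=
  iSup₂_le fun _ ht =>
    (circleLpNorm_add_le hp (hf.continuousOn.mono (sphere_subset_unitBall ht))
      (hg.continuousOn.mono (sphere_subset_unitBall ht))).trans
      (add_le_add (circleLpNorm_le_hardyNorm p f ht) (circleLpNorm_le_hardyNorm p g ht))

theorem hardyNorm_neg (p : ℝ≥0∞) (f : ℂ → ℂ) : hardyNorm p (fun z => -f z) = hardyNorm p f :=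
  le_antisymm (hardyNorm_mono p fun z _ => by simp) (hardyNorm_mono p fun z _ => by simp)

theorem hardyNorm_sub_le {f g : ℂ → ℂ} {p : ℝ≥0∞} (hp : 1 ≤ p)
    (hf : DifferentiableOn ℂ f (Metric.ball 0 1)) (hg : DifferentiableOn ℂ g (Metric.ball 0 1)) :
    hardyNorm p (fun z => f z - g z) ≤ hardyNorm p f + hardyNorm p g := by
  have h := hardyNorm_add_le hp hf hg.neg
  simp only [Pi.neg_apply, ← sub_eq_add_neg] at h
  rwa [show hardyNorm p (-g) = hardyNorm p g from hardyNorm_neg p g] at h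

theorem hardyNorm_const_mul (p : ℝ≥0∞) (c : ℂ) (f : ℂ → ℂ) :
    hardyNorm p (fun z => c * f z) = ENNReal.ofReal ‖c‖ * hardyNorm p f := by
  rw [hardyNorm_eq_iSup, hardyNorm_eq_iSup, ENNReal.mul_iSup]
  refine iSup_congr fun t => ?_
  rw [ENNReal.mul_iSup]
  refine iSup_congr fun _ => ?_
  rw [ofReal_norm]
  exact eLpNorm_const_smul c (fun θ : ℝ => f (circleMap 0 t θ)) p circleMeasure

theorem hardyNorm_sum_le {ι : Type*} (s : Finset ι) {f : ι → ℂ → ℂ} {p : ℝ≥0∞} (hp : 1 ≤ p)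
    (hf : ∀ i ∈ s, DifferentiableOn ℂ (f i) (Metric.ball 0 1)) :
    hardyNorm p (fun z => ∑ i ∈ s, f i z) ≤ ∑ i ∈ s, hardyNorm p (f i) := by
  classical
  induction s using Finset.induction_on with
  | empty => simpa using hardyNorm_le_of_forall_norm_le (f := fun _ => 0) (B := 0) p (by simp)
  | insert i s hi ih =>
    simp only [Finset.sum_insert hi]
    refine (hardyNorm_add_le hp (hf i (Finset.mem_insert_self i s))
      (DifferentiableOn.fun_sum fun j hj => hf j (Finset.mem_insert_of_mem hj))).trans ?_
    gcongr
    exact ih fun j hj => hf j (Finset.mem_insert_of_mem hj)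

/-! ### Approximation by Taylor polynomials and monotonicity of the means -/

theorem exists_polynomial_norm_sub_le {f : ℂ → ℂ} {R ρ : ℝ} (hρ0 : 0 ≤ ρ) (hρ : ρ < R)
    (hf : DifferentiableOn ℂ f (Metric.ball 0 R)) {ε : ℝ} (hε : 0 < ε) :
    ∃ g : Polynomial ℂ, ∀ z ∈ Metric.closedBall (0 : ℂ) ρ, ‖f z - g.eval z‖ ≤ ε := by
  obtain ⟨a, ha, haR⟩ := exists_between hρ
  obtain ⟨b, hb, hba⟩ := exists_between ha
  lift a to NNReal using hρ0.trans ha.le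
  lift b to NNReal using hρ0.trans hb.le
  have hps := DifferentiableOn.hasFPowerSeriesOnBall (c := 0) (R := a)
    (hf.mono (Metric.closedBall_subset_ball haR)) (by exact_mod_cast hρ0.trans_lt ha)
  have hu := hps.tendstoUniformlyOn (r' := b) (by exact_mod_cast hba)
  obtain ⟨N, hN⟩ := (Metric.tendstoUniformlyOn_iff.1 hu ε hε).exists
  refine ⟨∑ k ∈ Finset.range N,
    Polynomial.monomial k ((cauchyPowerSeries f 0 a).coeff k), fun z hz => ?_⟩
  have hz' : z ∈ Metric.ball (0 : ℂ) b :=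
    Metric.closedBall_subset_ball hb hz
  have h := (hN z hz').le
  rw [dist_eq_norm, zero_add, FormalMultilinearSeries.partialSum] at h
  simpa only [Polynomial.eval_finsetSum, Polynomial.eval_monomial, smul_eq_mul, mul_comm,
    FormalMultilinearSeries.apply_eq_pow_smul_coeff] using h

theorem circleLpNorm_comp_mul_rotation {f : ℂ → ℂ} {t : ℝ} {p : ℝ≥0∞} (hp0 : p ≠ 0) (hp : p ≠ ∞)
    (hf : ContinuousOn f (Metric.sphere 0 |t|)) (α : ℝ) :
    eLpNorm (fun θ : ℝ => f (circleMap 0 t (θ + α))) p circleMeasure = circleLpNorm p f t := by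
  have hm : MemLp (fun θ : ℝ => f (circleMap 0 t (θ + α))) p circleMeasure := by
    obtain ⟨C, hC⟩ := (isCompact_sphere (0 : ℂ) |t|).exists_bound_of_continuousOn hf
    exact MemLp.of_bound ((continuous_comp_circleMap hf).comp
      (continuous_id.add continuous_const)).aestronglyMeasurable C
      (Eventually.of_forall fun θ => hC _ (circleMap_mem_sphere' 0 t _))
  rw [hm.eLpNorm_eq_integral_rpow_norm hp0 hp, circleLpNorm_eq_ofReal hp0 hp hf,
    Real.circleAverage_eq_integral_add α, circleMeasure, integral_smul_measure,
    intervalIntegral.integral_of_le Real.two_pi_pos.le, ENNReal.toReal_inv,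
    ENNReal.toReal_ofReal Real.two_pi_pos.le]

/-- The function `Φ(z) = g(z e^{iθ})`, with values in `L^p(dθ)`, is entire, and by rotation
invariance its norm at `z` is the mean of `g` over the circle of radius `|z|`. The claim is the
maximum principle for `Φ`. -/
theorem circleLpNorm_polynomial_mono (g : Polynomial ℂ) {p : ℝ≥0∞} (hp1 : 1 ≤ p) (hp : p ≠ ∞)
    {s t : ℝ} (hs : 0 < s) (hst : s ≤ t) :
    circleLpNorm p (fun z => g.eval z) s ≤ circleLpNorm p (fun z => g.eval z) t := by
  have hp0 : p ≠ 0 := (zero_lt_one.trans_le hp1).ne'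
  have ht : 0 < t := hs.trans_le hst
  have : Fact (1 ≤ p) := ⟨hp1⟩
  have he : ∀ h : Polynomial ℂ, ∀ u : ℝ,
      MemLp (fun θ : ℝ => h.eval (circleMap 0 u θ)) p circleMeasure := fun h u =>
    memLp_comp_circleMap (f := fun z => h.eval z) p h.continuous.continuousOn
  have hk : ∀ k : ℕ, MemLp (fun θ : ℝ => circleMap 0 1 θ ^ k) p circleMeasure := fun k => by
    simpa using he (Polynomial.X ^ k) 1
  let Φ : ℂ → Lp ℂ p circleMeasure := fun z =>
    ∑ k ∈ Finset.range (g.natDegree + 1), (g.coeff k * z ^ k) • (hk k).toLp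
  have hΦ : ∀ u α : ℝ, eLpNorm (Φ (circleMap 0 u α)) p circleMeasure =
      circleLpNorm p (fun z => g.eval z) u := by
    intro u α
    rw [← circleLpNorm_comp_mul_rotation hp0 hp g.continuous.continuousOn α]
    refine eLpNorm_congr_ae ?_
    have h1 : Φ (circleMap 0 u α) =ᵐ[circleMeasure] fun θ =>
        ∑ k ∈ Finset.range (g.natDegree + 1), (g.coeff k * circleMap 0 u α ^ k) *
          circleMap 0 1 θ ^ k := by
      have h2 : ∀ k ∈ Finset.range (g.natDegree + 1),
          ((g.coeff k * circleMap 0 u α ^ k) • (hk k).toLp : Lp ℂ p circleMeasure)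
            =ᵐ[circleMeasure] fun θ => (g.coeff k * circleMap 0 u α ^ k) *
              circleMap 0 1 θ ^ k := fun k _ => by
        filter_upwards [Lp.coeFn_smul (g.coeff k * circleMap 0 u α ^ k) (hk k).toLp,
          (hk k).coeFn_toLp] with θ h3 h4
        rw [h3, Pi.smul_apply, h4, smul_eq_mul]
      have h5 : ∀ᵐ θ ∂circleMeasure, ∀ k ∈ Finset.range (g.natDegree + 1),
          ((g.coeff k * circleMap 0 u α ^ k) • (hk k).toLp : Lp ℂ p circleMeasure) θ
            = (g.coeff k * circleMap 0 u α ^ k) * circleMap 0 1 θ ^ k :=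
        (Finset.eventually_all _).2 h2
      filter_upwards [h5, Lp.coeFn_finsetSum (Finset.range (g.natDegree + 1)) (fun k =>
        ((g.coeff k * circleMap 0 u α ^ k) • (hk k).toLp : Lp ℂ p circleMeasure))] with θ h6 h7
      rw [h7, Finset.sum_apply]
      exact Finset.sum_congr rfl h6
    filter_upwards [h1] with θ hθ
    rw [hθ, Polynomial.eval_eq_sum_range]
    refine Finset.sum_congr rfl fun k _ => ?_
    rw [mul_assoc, ← mul_pow]
    congr 2
    simp only [circleMap_zero, Complex.ofReal_one, Complex.ofReal_add, add_mul, Complex.exp_add]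
    ring
  have hn : ∀ u α : ℝ, ‖Φ (circleMap 0 u α)‖ = (circleLpNorm p (fun z => g.eval z) u).toReal :=
    fun u α => by rw [Lp.norm_def, hΦ]
  have hd : Differentiable ℂ Φ := by fun_prop
  have hmax := Complex.norm_le_of_forall_mem_frontier_norm_le (U := Metric.ball (0 : ℂ) t)
    (f := Φ) Metric.isBounded_ball hd.diffContOnCl
    (C := (circleLpNorm p (fun z => g.eval z) t).toReal) (z := circleMap 0 s 0)
    (fun z hz => by
      rw [frontier_ball _ ht.ne', mem_sphere_zero_iff_norm] at hz
      have : z = circleMap 0 t z.arg := by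
        rw [circleMap_zero, ← hz, Complex.norm_mul_exp_arg_mul_I]
      rw [this, hn])
    (by
      rw [closure_ball _ ht.ne', mem_closedBall_zero_iff]
      simpa [abs_of_pos hs] using hst)
  rw [hn] at hmax
  exact (ENNReal.toReal_le_toReal (he g s).2.ne (he g t).2.ne).1 hmax

/-- Reduces to polynomials, since `f` is uniformly close to one on the closed disk of radius `t <
1`. -/
theorem circleLpNorm_mono {f : ℂ → ℂ} {p : ℝ≥0∞} (hp1 : 1 ≤ p) (hp : p ≠ ∞)
    (hf : DifferentiableOn ℂ f (Metric.ball 0 1)) {s t : ℝ} (hs : 0 < s) (hst : s ≤ t)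
    (ht : t < 1) : circleLpNorm p f s ≤ circleLpNorm p f t := by
  refine ENNReal.le_of_forall_pos_le_add fun ε hε _ => ?_
  have hε2 : (0 : ℝ) < ε / 2 := by positivity
  have ht0 : 0 < t := hs.trans_le hst
  obtain ⟨g, hg⟩ := exists_polynomial_norm_sub_le ht0.le ht hf hε2
  have hfc : ∀ {u : ℝ}, 0 < u → u ≤ t → ContinuousOn f (Metric.sphere 0 |u|) := fun h0 h1 =>
    hf.continuousOn.mono (sphere_subset_unitBall ⟨h0, h1.trans_lt ht⟩)
  have hgc : ∀ {u : ℝ}, ContinuousOn (fun z => g.eval z) (Metric.sphere 0 |u|) :=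
    g.continuous.continuousOn
  have hb : ∀ {u : ℝ}, 0 < u → u ≤ t → ∀ z ∈ Metric.sphere (0 : ℂ) |u|,
      ‖f z - g.eval z‖ ≤ ε / 2 := fun h0 h1 z hz => hg z (by
    rw [abs_of_pos h0] at hz
    exact Metric.closedBall_subset_closedBall h1 (Metric.sphere_subset_closedBall hz))
  calc circleLpNorm p f s
      = circleLpNorm p (fun z => (f z - g.eval z) + g.eval z) s := by simp
    _ ≤ ENNReal.ofReal (ε / 2) + circleLpNorm p (fun z => g.eval z) s :=
      (circleLpNorm_add_le hp1 ((hfc hs hst).sub hgc) hgc).trans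
        (add_le_add_left (circleLpNorm_le_of_forall_norm_le p (hb hs hst)) _)
    _ ≤ ENNReal.ofReal (ε / 2) + circleLpNorm p (fun z => g.eval z) t := by
      gcongr
      exact circleLpNorm_polynomial_mono g hp1 hp hs hst
    _ = ENNReal.ofReal (ε / 2) + circleLpNorm p (fun z => (g.eval z - f z) + f z) t := by simp
    _ ≤ ENNReal.ofReal (ε / 2) + (ENNReal.ofReal (ε / 2) + circleLpNorm p f t) := by
      gcongr
      refine (circleLpNorm_add_le hp1 (hgc.sub (hfc ht0 le_rfl)) (hfc ht0 le_rfl)).trans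
        (add_le_add_left (circleLpNorm_le_of_forall_norm_le p fun z hz => ?_) _)
      rw [Pi.sub_apply, norm_sub_rev]
      exact hb ht0 le_rfl z hz
    _ = circleLpNorm p f t + ε := by
      rw [← add_assoc, ← ENNReal.ofReal_add hε2.le hε2.le, add_halves, add_comm,
        ENNReal.ofReal_coe_nnreal]

/-! ### Density of the polynomials -/

/-- If the norms agree, strictness comes from strict convexity of the Euclidean norm; otherwise from
that of `x ↦ x ^ q`. -/
theorem norm_midpoint_rpow_lt {a b : ℂ} (hab : a ≠ b) {q : ℝ} (hq : 1 < q) :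
    ‖(a + b) / 2‖ ^ q < (‖a‖ ^ q + ‖b‖ ^ q) / 2 := by
  have h2 : ‖(a + b) / 2‖ = ‖a + b‖ / 2 := by simp
  by_cases h : ‖a‖ = ‖b‖
  · have h1 : ‖(a + b) / 2‖ < ‖b‖ := by
      have := (norm_midpoint_lt_iff h).2 hab
      rw [h2]
      simp only [norm_smul] at this
      norm_num at this
      linarith
    have := Real.rpow_lt_rpow (norm_nonneg _) h1 (by linarith : 0 < q)
    rw [h]
    linarith
  · have h1 : ‖(a + b) / 2‖ ≤ (1 / 2 : ℝ) * ‖a‖ + (1 / 2 : ℝ) * ‖b‖ := by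
      rw [h2]
      linarith [norm_add_le a b]
    have h3 := (strictConvexOn_rpow hq).2 (Set.mem_Ici.2 (norm_nonneg a))
      (Set.mem_Ici.2 (norm_nonneg b)) h (by norm_num : (0 : ℝ) < 1 / 2)
      (by norm_num : (0 : ℝ) < 1 / 2) (by norm_num)
    have h4 := Real.rpow_le_rpow (norm_nonneg _) h1 (by linarith : 0 ≤ q)
    simp only [smul_eq_mul] at h3
    linarith

theorem norm_midpoint_rpow_le (a b : ℂ) {q : ℝ} (hq : 1 < q) :
    ‖(a + b) / 2‖ ^ q ≤ (‖a‖ ^ q + ‖b‖ ^ q) / 2 := by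
  by_cases h : a = b
  · subst h
    simp
  · exact (norm_midpoint_rpow_lt h hq).le

/-- A homogeneous quantitative form of the uniform convexity of `x ↦ ‖x‖ ^ q`. -/
theorem exists_norm_sub_rpow_le {q : ℝ} (hq : 1 < q) {η : ℝ} (hη : 0 < η) :
    ∃ C : ℝ, 0 ≤ C ∧ ∀ a b : ℂ, ‖a - b‖ ^ q ≤ η * (‖a‖ ^ q + ‖b‖ ^ q) +
      C * ((‖a‖ ^ q + ‖b‖ ^ q) / 2 - ‖(a + b) / 2‖ ^ q) := by
  have hq0 : 0 < q := by linarith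
  have hq0' : 0 ≤ q := hq0.le
  let δ : ℂ × ℂ → ℝ := fun x => (‖x.1‖ ^ q + ‖x.2‖ ^ q) / 2 - ‖(x.1 + x.2) / 2‖ ^ q
  have hδc : Continuous δ := by
    have h1 := (Real.continuous_rpow_const hq0').comp (continuous_fst (X := ℂ) (Y := ℂ)).norm
    have h2 := (Real.continuous_rpow_const hq0').comp (continuous_snd (X := ℂ) (Y := ℂ)).norm
    have h3 := (Real.continuous_rpow_const hq0').comp
      (((continuous_fst (X := ℂ) (Y := ℂ)).add continuous_snd).div_const 2).norm
    exact ((h1.add h2).div_const 2).sub h3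
  have hδ0 : ∀ x, 0 ≤ δ x := fun x => sub_nonneg.2 (norm_midpoint_rpow_le x.1 x.2 hq)
  have hsc : Continuous fun x : ℂ × ℂ => ‖x.1 - x.2‖ ^ q :=
    (Real.continuous_rpow_const hq0').comp (continuous_fst.sub continuous_snd).norm
  -- Both sides of the inequality are homogeneous of degree `q`, so the unit sphere suffices. On its
  -- compact part `K`, where the two points are apart, the convexity defect `δ` has a positive
  -- minimum.
  let K : Set (ℂ × ℂ) := Metric.sphere 0 1 ∩ {x | η ≤ ‖x.1 - x.2‖ ^ q}
  have hK : IsCompact K :=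
    (isCompact_sphere _ _).inter_right (isClosed_le continuous_const hsc)
  have hsphere : ∃ C : ℝ, 0 ≤ C ∧ ∀ x ∈ Metric.sphere (0 : ℂ × ℂ) 1,
      ‖x.1 - x.2‖ ^ q ≤ η * (‖x.1‖ ^ q + ‖x.2‖ ^ q) + C * δ x := by
    obtain ⟨c, hc, hcK⟩ : ∃ c : ℝ, 0 < c ∧ ∀ x ∈ K, c ≤ δ x := by
      rcases K.eq_empty_or_nonempty with h | h
      · exact ⟨1, one_pos, by simp [h]⟩
      · obtain ⟨x, hx, hmin⟩ := hK.exists_isMinOn h hδc.continuousOn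
        refine ⟨δ x, sub_pos.2 (norm_midpoint_rpow_lt (fun hxx => ?_) hq), fun y hy => hmin hy⟩
        have h1 : η ≤ ‖x.1 - x.2‖ ^ q := hx.2
        rw [hxx, sub_self, norm_zero, Real.zero_rpow hq0.ne'] at h1
        linarith
    -- On the sphere of the max norm `‖x.1 - x.2‖ ≤ 2`, so this constant makes the `δ` term suffice
    -- on `K`. Off `K` the `η` term suffices, one of the two norms being `1`.
    refine ⟨2 ^ q / c, by positivity, fun x hx => ?_⟩
    have hx1 : max ‖x.1‖ ‖x.2‖ = 1 := by
      rw [← Prod.norm_def]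
      simpa using hx
    have hle1 : ‖x.1‖ ≤ 1 := hx1 ▸ le_max_left _ _
    have hle2 : ‖x.2‖ ≤ 1 := hx1 ▸ le_max_right _ _
    have h0 : (0 : ℝ) ≤ ‖x.1‖ ^ q := by positivity
    have h0' : (0 : ℝ) ≤ ‖x.2‖ ^ q := by positivity
    by_cases hxK : η ≤ ‖x.1 - x.2‖ ^ q
    · have h1 : ‖x.1 - x.2‖ ^ q ≤ 2 ^ q :=
        Real.rpow_le_rpow (norm_nonneg _) (by linarith [norm_sub_le x.1 x.2]) hq0'
      have h2 : 2 ^ q / c * c ≤ 2 ^ q / c * δ x := by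
        gcongr
        exact hcK x ⟨hx, hxK⟩
      rw [div_mul_cancel₀ _ hc.ne'] at h2
      have : 0 ≤ η * (‖x.1‖ ^ q + ‖x.2‖ ^ q) := by positivity
      linarith
    · have h1 : 1 ≤ ‖x.1‖ ^ q + ‖x.2‖ ^ q := by
        rcases max_choice ‖x.1‖ ‖x.2‖ with h | h
        · rw [hx1] at h
          rw [← h, Real.one_rpow]
          linarith
        · rw [hx1] at h
          rw [← h, Real.one_rpow]
          linarith
      have h2 : 0 ≤ 2 ^ q / c * δ x := mul_nonneg (by positivity) (hδ0 x)
      have h3 : η * 1 ≤ η * (‖x.1‖ ^ q + ‖x.2‖ ^ q) := by gcongr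
      linarith
  obtain ⟨C, hC0, hC⟩ := hsphere
  refine ⟨C, hC0, fun a b => ?_⟩
  by_cases h0 : ((a, b) : ℂ × ℂ) = 0
  · have ha : a = 0 := congrArg Prod.fst h0
    have hb : b = 0 := congrArg Prod.snd h0
    simp [ha, hb, Real.zero_rpow hq0.ne']
  have hN : 0 < ‖((a, b) : ℂ × ℂ)‖ := norm_pos_iff.2 h0
  set N := ‖((a, b) : ℂ × ℂ)‖ with hNdef
  have hmem : ((N : ℂ)⁻¹ * a, (N : ℂ)⁻¹ * b) ∈ Metric.sphere (0 : ℂ × ℂ) 1 := by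
    rw [mem_sphere_zero_iff_norm, Prod.norm_def, norm_mul, norm_mul, norm_inv, Complex.norm_real,
      Real.norm_of_nonneg hN.le, ← mul_max_of_nonneg _ _ (inv_nonneg.2 hN.le)]
    rw [hNdef, Prod.norm_def] at hN ⊢
    exact inv_mul_cancel₀ hN.ne'
  have hscale : ∀ z : ℂ, ‖(N : ℂ)⁻¹ * z‖ ^ q = N⁻¹ ^ q * ‖z‖ ^ q := fun z => by
    rw [norm_mul, norm_inv, Complex.norm_real, Real.norm_of_nonneg hN.le,
      Real.mul_rpow (inv_nonneg.2 hN.le) (norm_nonneg _)]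
  have h1 := hC _ hmem
  simp only [δ] at h1
  rw [← mul_sub, ← mul_add, mul_div_assoc] at h1
  simp only [hscale] at h1
  have hpos : 0 < N⁻¹ ^ q := by positivity
  refine le_of_mul_le_mul_left ?_ hpos
  calc _ ≤ _ := h1
    _ = _ := by ring

theorem circleAverage_norm_sub_rpow_le {u v : ℂ → ℂ} {t q η C : ℝ} (hq : 0 ≤ q)
    (hu : ContinuousOn u (Metric.sphere 0 |t|)) (hv : ContinuousOn v (Metric.sphere 0 |t|))
    (h : ∀ a b : ℂ, ‖a - b‖ ^ q ≤ η * (‖a‖ ^ q + ‖b‖ ^ q) +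
      C * ((‖a‖ ^ q + ‖b‖ ^ q) / 2 - ‖(a + b) / 2‖ ^ q)) :
    Real.circleAverage (fun z => ‖u z - v z‖ ^ q) 0 t ≤
      η * (Real.circleAverage (fun z => ‖u z‖ ^ q) 0 t +
        Real.circleAverage (fun z => ‖v z‖ ^ q) 0 t) +
      C * ((Real.circleAverage (fun z => ‖u z‖ ^ q) 0 t +
        Real.circleAverage (fun z => ‖v z‖ ^ q) 0 t) / 2 -
          Real.circleAverage (fun z => ‖(u z + v z) / 2‖ ^ q) 0 t) := by
  have hint : ∀ w : ℂ → ℂ, ContinuousOn w (Metric.sphere 0 |t|) →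
      CircleIntegrable (fun z => ‖w z‖ ^ q) 0 t := fun w hw =>
    (hw.norm.rpow_const fun _ _ => Or.inr hq).circleIntegrable'
  have i1 := hint u hu
  have i2 := hint v hv
  have i3 := hint (fun z => u z - v z) (hu.sub hv)
  have i4 := hint (fun z => (u z + v z) / 2) ((hu.add hv).div_const 2)
  unfold CircleIntegrable at i1 i2 i3 i4
  have hmain : ∫ θ in (0 : ℝ)..2 * Real.pi, ‖u (circleMap 0 t θ) - v (circleMap 0 t θ)‖ ^ q ≤
      ∫ θ in (0 : ℝ)..2 * Real.pi, ((η + C / 2) * ‖u (circleMap 0 t θ)‖ ^ q +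
        (η + C / 2) * ‖v (circleMap 0 t θ)‖ ^ q -
          C * ‖(u (circleMap 0 t θ) + v (circleMap 0 t θ)) / 2‖ ^ q) := by
    refine intervalIntegral.integral_mono_on Real.two_pi_pos.le i3
      (((i1.const_mul _).add (i2.const_mul _)).sub (i4.const_mul _)) fun θ _ => ?_
    linarith [h (u (circleMap 0 t θ)) (v (circleMap 0 t θ))]
  rw [intervalIntegral.integral_sub ((i1.const_mul _).add (i2.const_mul _)) (i4.const_mul _),
    intervalIntegral.integral_add (i1.const_mul _) (i2.const_mul _),
    intervalIntegral.integral_const_mul, intervalIntegral.integral_const_mul,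
    intervalIntegral.integral_const_mul] at hmain
  have h2 := mul_le_mul_of_nonneg_left hmain (inv_nonneg.2 Real.two_pi_pos.le)
  simp only [Real.circleAverage_def, smul_eq_mul]
  linarith

theorem circleAverage_rpow_mono {f : ℂ → ℂ} {p : ℝ≥0∞} (hp1 : 1 ≤ p) (hp : p ≠ ∞)
    (hf : DifferentiableOn ℂ f (Metric.ball 0 1)) {s t : ℝ} (hs : 0 < s) (hst : s ≤ t)
    (ht : t < 1) :
    Real.circleAverage (fun z => ‖f z‖ ^ p.toReal) 0 s ≤
      Real.circleAverage (fun z => ‖f z‖ ^ p.toReal) 0 t := by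
  have hp0 : p ≠ 0 := (zero_lt_one.trans_le hp1).ne'
  have hq : 0 < p.toReal := ENNReal.toReal_pos hp0 hp
  have h := circleLpNorm_mono hp1 hp hf hs hst ht
  rw [circleLpNorm_eq_ofReal (t := t) hp0 hp
    (hf.continuousOn.mono (sphere_subset_unitBall ⟨hs.trans_le hst, ht⟩)),
    circleLpNorm_le_ofReal_iff hp0 hp (hf.continuousOn.mono
      (sphere_subset_unitBall ⟨hs, hst.trans_lt ht⟩))
      (Real.rpow_nonneg (circleAverage_rpow_nonneg f _ t) _),
    Real.rpow_inv_rpow (circleAverage_rpow_nonneg f _ t) hq.ne'] at h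
  exact h

theorem mul_mem_unitBall {ρ : ℝ} (hρ : ρ ∈ Set.Ioo (0 : ℝ) 1) {z : ℂ}
    (hz : z ∈ Metric.ball (0 : ℂ) 1) : (ρ : ℂ) * z ∈ Metric.ball (0 : ℂ) 1 := by
  rw [mem_ball_zero_iff] at hz ⊢
  rw [norm_mul, Complex.norm_real, Real.norm_of_nonneg hρ.1.le]
  exact mul_lt_one_of_nonneg_of_lt_one_left hρ.1.le hρ.2 hz.le

theorem differentiableOn_dilation {f : ℂ → ℂ} (hf : DifferentiableOn ℂ f (Metric.ball 0 1))
    {ρ : ℝ} (hρ : ρ ∈ Set.Ioo (0 : ℝ) 1) :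
    DifferentiableOn ℂ (fun z => f (ρ * z)) (Metric.ball 0 1) :=
  hf.comp (differentiableOn_id.const_mul _) fun _ hz => mul_mem_unitBall hρ hz

theorem circleAverage_dilation (u : ℂ → ℝ) (ρ t : ℝ) :
    Real.circleAverage (fun z => u (ρ * z)) 0 t = Real.circleAverage u 0 (ρ * t) := by
  simp only [Real.circleAverage_def, circleMap_zero, Complex.ofReal_mul, mul_assoc]

/-- Dominated convergence on one fixed circle inside the disk, where everything is bounded. -/
theorem tendsto_circleAverage_midpoint_dilation {f : ℂ → ℂ}
    (hf : DifferentiableOn ℂ f (Metric.ball 0 1)) {q s : ℝ} (hq : 0 < q)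
    (hs : s ∈ Set.Ioo (0 : ℝ) 1) :
    Tendsto (fun ρ : ℝ => Real.circleAverage (fun z => ‖(f z + f (ρ * z)) / 2‖ ^ q) 0 s)
      (𝓝[<] 1) (𝓝 (Real.circleAverage (fun z => ‖f z‖ ^ q) 0 s)) := by
  simp only [← integral_circleMeasure]
  have hρ : ∀ᶠ ρ : ℝ in 𝓝[<] 1, ρ ∈ Set.Ioo (0 : ℝ) 1 := Ioo_mem_nhdsLT zero_lt_one
  obtain ⟨B, hB⟩ := (isCompact_closedBall (0 : ℂ) s).exists_bound_of_continuousOn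
    (hf.continuousOn.mono (Metric.closedBall_subset_ball hs.2))
  refine tendsto_integral_filter_of_dominated_convergence (fun _ => B ^ q) ?_ ?_
    (integrable_const _) ?_
  · filter_upwards [hρ] with ρ hρ
    have h1 : ContinuousOn (fun z => (f z + f (ρ * z)) / 2) (Metric.sphere 0 |s|) :=
      ((hf.continuousOn.add (differentiableOn_dilation hf hρ).continuousOn).div_const 2).mono
        (sphere_subset_unitBall hs)
    exact ((Real.continuous_rpow_const hq.le).comp
      (continuous_comp_circleMap h1).norm).aestronglyMeasurable
  · filter_upwards [hρ] with ρ hρ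
    refine Eventually.of_forall fun θ => ?_
    have hz : ‖circleMap 0 s θ‖ = s := by simp [abs_of_pos hs.1]
    have h1 := hB (circleMap 0 s θ) (by simp [hz])
    have h2 := hB (ρ * circleMap 0 s θ) (by
      rw [mem_closedBall_zero_iff, norm_mul, hz, Complex.norm_real, Real.norm_of_nonneg hρ.1.le]
      exact mul_le_of_le_one_left hs.1.le hρ.2.le)
    rw [Real.norm_of_nonneg (by positivity)]
    refine Real.rpow_le_rpow (norm_nonneg _) ?_ hq.le
    rw [norm_div, Complex.norm_ofNat]
    linarith [norm_add_le (f (circleMap 0 s θ)) (f (ρ * circleMap 0 s θ))]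
  · refine Eventually.of_forall fun θ => ?_
    set z := circleMap 0 s θ with hz
    have hzb : z ∈ Metric.ball (0 : ℂ) 1 := circleMap_mem_unitBall hs θ
    have hc : ContinuousAt f z :=
      hf.continuousOn.continuousAt (Metric.isOpen_ball.mem_nhds hzb)
    have h1 : Tendsto (fun ρ : ℝ => (ρ : ℂ) * z) (𝓝[<] 1) (𝓝 z) := by
      have : Tendsto (fun ρ : ℝ => (ρ : ℂ) * z) (𝓝 1) (𝓝 (((1 : ℝ) : ℂ) * z)) :=
        (Complex.continuous_ofReal.mul continuous_const).tendsto 1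
      rw [Complex.ofReal_one, one_mul] at this
      exact this.mono_left nhdsWithin_le_nhds
    have h2 : Tendsto (fun ρ : ℝ => (f z + f (ρ * z)) / 2) (𝓝[<] 1) (𝓝 (f z)) := by
      have := (tendsto_const_nhds (x := f z)).add (hc.tendsto.comp h1) |>.div_const 2
      rwa [add_self_div_two] at this
    exact h2.norm.rpow_const (Or.inr hq.le)

/-- Let `S` be the supremum of the `q`-th power means of `f`. For `ρ` near `1` the midpoint of `f`
and its dilation has mean almost `S` on one circle, hence, by monotonicity, on all larger ones.
Neither `f` nor the dilation has means above `S`, so uniform convexity forces them to be close. -/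
theorem MemHardy.exists_dilation {f : ℂ → ℂ} {p : ℝ≥0∞} (hp1 : 1 < p) (hp : p < ∞)
    (hf : MemHardy p f) {ε : ℝ} (hε : 0 < ε) :
    ∃ ρ ∈ Set.Ioo (0 : ℝ) 1, hardyNorm p (fun z => f z - f (ρ * z)) ≤ ENNReal.ofReal ε := by
  obtain ⟨hd, hfin⟩ := hf
  have hp0 : p ≠ 0 := (zero_lt_one.trans hp1).ne'
  set q := p.toReal with hqdef
  have hq : 1 < q := by
    rw [hqdef, ← ENNReal.toReal_one]
    exact (ENNReal.toReal_lt_toReal ENNReal.one_ne_top hp.ne).2 hp1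
  have hq0 : 0 < q := by linarith
  let m : (ℂ → ℂ) → ℝ → ℝ := fun h t => Real.circleAverage (fun z => ‖h z‖ ^ q) 0 t
  have hmono : ∀ {h : ℂ → ℂ}, DifferentiableOn ℂ h (Metric.ball 0 1) → ∀ {s t : ℝ}, 0 < s →
      s ≤ t → t < 1 → m h s ≤ m h t := fun hh _ _ h1 h2 h3 =>
    circleAverage_rpow_mono hp1.le hp.ne hh h1 h2 h3
  have hbdd : ∀ t ∈ Set.Ioo (0 : ℝ) 1, m f t ≤ (hardyNorm p f).toReal ^ q := fun t ht => by
    refine (circleLpNorm_le_ofReal_iff hp0 hp.ne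
      (hd.continuousOn.mono (sphere_subset_unitBall ht)) ENNReal.toReal_nonneg).1 ?_
    rw [ENNReal.ofReal_toReal hfin.ne]
    exact circleLpNorm_le_hardyNorm p f ht
  set S := sSup (m f '' Set.Ioo 0 1) with hS
  have hle : ∀ t ∈ Set.Ioo (0 : ℝ) 1, m f t ≤ S := fun t ht =>
    le_csSup ⟨_, Set.forall_mem_image.2 hbdd⟩ (Set.mem_image_of_mem _ ht)
  have hS0 : 0 ≤ S := (circleAverage_rpow_nonneg f q (1 / 2)).trans
    (hle (1 / 2) ⟨by norm_num, by norm_num⟩)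
  have hεq : 0 < ε ^ q := by positivity
  -- The two means add up to at most `2 S`, so the `η` term will be at most `ε ^ q / 2`; the `+ 1`
  -- guards against `S = 0`. The margin `ε ^ q / (4 * (C + 1))` below, used twice, does the same for
  -- the `C` term.
  obtain ⟨C, hC0, hC⟩ := exists_norm_sub_rpow_le hq (η := ε ^ q / (4 * (S + 1))) (by positivity)
  obtain ⟨_, ⟨s, hs, rfl⟩, hsS⟩ := exists_lt_of_lt_csSup
    (Set.image_nonempty.2 (Set.nonempty_Ioo.2 zero_lt_one))
    (show S - ε ^ q / (4 * (C + 1)) < sSup (m f '' Set.Ioo 0 1) by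
      rw [← hS]
      have : 0 < ε ^ q / (4 * (C + 1)) := by positivity
      linarith)
  have hev := (tendsto_circleAverage_midpoint_dilation hd hq0 hs).eventually_const_lt
    (show S - 2 * (ε ^ q / (4 * (C + 1))) < _ by
      have : 0 < ε ^ q / (4 * (C + 1)) := by positivity
      have h2 : m f s = Real.circleAverage (fun z => ‖f z‖ ^ q) 0 s := rfl
      linarith)
  have hIoo : ∀ᶠ ρ : ℝ in 𝓝[<] 1, ρ ∈ Set.Ioo (0 : ℝ) 1 := Ioo_mem_nhdsLT zero_lt_one
  obtain ⟨ρ, hρS, hρ⟩ := (hev.and hIoo).exists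
  refine ⟨ρ, hρ, ?_⟩
  have hdρ := differentiableOn_dilation hd hρ
  have hdiff : DifferentiableOn ℂ (fun z => f z - f (ρ * z)) (Metric.ball 0 1) := hd.sub hdρ
  have hmid : DifferentiableOn ℂ (fun z => (f z + f (ρ * z)) / 2) (Metric.ball 0 1) :=
    (hd.add hdρ).div_const 2
  have hmain : ∀ t, s ≤ t → t < 1 → m (fun z => f z - f (ρ * z)) t ≤ ε ^ q := by
    intro t hst ht1
    have ht : t ∈ Set.Ioo (0 : ℝ) 1 := ⟨hs.1.trans_le hst, ht1⟩
    have hsph := sphere_subset_unitBall ht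
    have h1 : m (fun z => f z - f (ρ * z)) t ≤ ε ^ q / (4 * (S + 1)) *
        (m f t + m (fun z => f (ρ * z)) t) + C * ((m f t + m (fun z => f (ρ * z)) t) / 2 -
          m (fun z => (f z + f (ρ * z)) / 2) t) :=
      circleAverage_norm_sub_rpow_le hq0.le (hd.continuousOn.mono hsph)
        (hdρ.continuousOn.mono hsph) hC
    have h2 : m f t ≤ S := hle t ht
    have h3 : m (fun z => f (ρ * z)) t ≤ S := by
      have : m (fun z => f (ρ * z)) t = m f (ρ * t) :=
        circleAverage_dilation (fun z => ‖f z‖ ^ q) ρ t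
      rw [this]
      exact hle _ ⟨mul_pos hρ.1 ht.1, mul_lt_one_of_nonneg_of_lt_one_left hρ.1.le hρ.2 ht1.le⟩
    have h4 : S - 2 * (ε ^ q / (4 * (C + 1))) ≤ m (fun z => (f z + f (ρ * z)) / 2) t :=
      hρS.le.trans (hmono hmid hs.1 hst ht1)
    have h5 : ε ^ q / (4 * (S + 1)) * (m f t + m (fun z => f (ρ * z)) t) ≤
        ε ^ q / (4 * (S + 1)) * (2 * (S + 1)) := by
      gcongr
      linarith
    have h6 : C * ((m f t + m (fun z => f (ρ * z)) t) / 2 -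
          m (fun z => (f z + f (ρ * z)) / 2) t) ≤ C * (2 * (ε ^ q / (4 * (C + 1)))) := by
      gcongr
      linarith
    have h7 : ε ^ q / (4 * (S + 1)) * (2 * (S + 1)) = ε ^ q / 2 := by
      field_simp
      norm_num
    have h8 : C * (2 * (ε ^ q / (4 * (C + 1)))) ≤ ε ^ q / 2 := by
      have : C * (2 * (ε ^ q / (4 * (C + 1)))) = C / (C + 1) * (ε ^ q / 2) := by
        field_simp
        norm_num
      rw [this]
      exact mul_le_of_le_one_left (by positivity)
        ((div_le_one (by positivity)).2 (by linarith))
    linarith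
  refine iSup₂_le fun t ht => ?_
  refine (circleLpNorm_le_ofReal_iff hp0 hp.ne
    (hdiff.continuousOn.mono (sphere_subset_unitBall ht)) hε.le).2 ?_
  -- The estimate is known only for radii at least `s`; smaller ones follow from monotonicity
  -- applied to the difference.
  rcases le_total s t with h | h
  · exact hmain t h ht.2
  · exact (hmono hdiff ht.1 h hs.2).trans (hmain s le_rfl hs.2)

theorem MemHardy.exists_polynomial {f : ℂ → ℂ} {p : ℝ≥0∞} (hp1 : 1 < p) (hp : p < ∞)
    (hf : MemHardy p f) {ε : ℝ} (hε : 0 < ε) :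
    ∃ g : Polynomial ℂ, hardyNorm p (fun z => f z - g.eval z) ≤ ENNReal.ofReal ε := by
  obtain ⟨ρ, hρ, hfρ⟩ := hf.exists_dilation hp1 hp (half_pos hε)
  obtain ⟨g, hg⟩ := exists_polynomial_norm_sub_le hρ.1.le hρ.2 hf.1 (half_pos hε)
  refine ⟨g.comp (Polynomial.C (ρ : ℂ) * Polynomial.X), ?_⟩
  have hdρ := differentiableOn_dilation hf.1 hρ
  have h1 : hardyNorm p (fun z => f (ρ * z) - g.eval (ρ * z)) ≤ ENNReal.ofReal (ε / 2) :=
    hardyNorm_le_of_forall_norm_le p fun z hz => hg _ (by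
      rw [mem_ball_zero_iff] at hz
      rw [mem_closedBall_zero_iff, norm_mul, Complex.norm_real, Real.norm_of_nonneg hρ.1.le]
      exact mul_le_of_le_one_right hρ.1.le hz.le)
  have h2 := hardyNorm_add_le hp1.le (hf.1.sub hdρ) (hdρ.sub
    ((g.differentiable.comp (differentiable_id.const_mul (ρ : ℂ))).differentiableOn))
  have h3 := h2.trans (add_le_add hfρ h1)
  rw [← ENNReal.ofReal_add (half_pos hε).le (half_pos hε).le, add_halves] at h3
  exact (hardyNorm_congr p fun z _ => by simp).trans_le h3

/-! ### Functions with bounded real part -/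

/-- The real part of `G = exp(-iσF)` is `exp(σ Im F) cos(σ Re F)`. The cosine is at least `1/2`
because `|σ Re F| ≤ 1`, and by the mean value property `Re G` averages to `Re G(0) ≤ 1`. -/
theorem circleAverage_exp_im_le {F : ℂ → ℂ} (hF : DifferentiableOn ℂ F (Metric.ball 0 1))
    (hre : ∀ z ∈ Metric.ball (0 : ℂ) 1, |(F z).re| ≤ 2) (h0 : (F 0).im = 0) {t : ℝ}
    (ht : t ∈ Set.Ioo (0 : ℝ) 1) {σ : ℝ} (hσ : |σ| = 1 / 2) :
    Real.circleAverage (fun z => Real.exp (σ * (F z).im)) 0 t ≤ 2 := by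
  let G : ℂ → ℂ := fun z => Complex.exp (-(σ * Complex.I) * F z)
  have hG : DifferentiableOn ℂ G (Metric.ball 0 1) := (hF.const_mul _).cexp
  have hsub : Metric.closedBall (0 : ℂ) |t| ⊆ Metric.ball 0 1 := by
    rw [abs_of_pos ht.1]
    exact Metric.closedBall_subset_ball ht.2
  have hsph := sphere_subset_unitBall ht
  have hre' : ∀ z, (-(σ * Complex.I) * F z).re = σ * (F z).im := fun z => by simp
  have him' : ∀ z, (-(σ * Complex.I) * F z).im = -(σ * (F z).re) := fun z => by simp
  have hmean : Real.circleAverage G 0 t = G 0 :=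
    DiffContOnCl.circleAverage
      ⟨hG.mono (Metric.ball_subset_closedBall.trans hsub),
        hG.continuousOn.mono (Metric.closure_ball_subset_closedBall.trans hsub)⟩
  have hGi : CircleIntegrable G 0 t :=
    (hG.continuousOn.mono hsph).circleIntegrable'
  have hmeanre : Real.circleAverage (fun z => (G z).re) 0 t = (G 0).re := by
    rw [← hmean]
    exact Complex.reCLM.circleAverage_comp_comm hGi
  have hG0 : (G 0).re ≤ 1 := by
    refine (Complex.re_le_norm _).trans ?_
    rw [Complex.norm_exp, hre', h0, mul_zero, Real.exp_zero]
  have hei : CircleIntegrable (fun z => Real.exp (σ * (F z).im)) 0 t :=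
    ContinuousOn.circleIntegrable' <| (Real.continuous_exp.comp_continuousOn
      (continuousOn_const.mul (Complex.continuous_im.comp_continuousOn hF.continuousOn))).mono hsph
  have hGre : CircleIntegrable (fun z => 2 * (G z).re) 0 t :=
    ContinuousOn.circleIntegrable' <|
      (continuousOn_const.mul (Complex.continuous_re.comp_continuousOn hG.continuousOn)).mono hsph
  calc Real.circleAverage (fun z => Real.exp (σ * (F z).im)) 0 t
      ≤ Real.circleAverage (fun z => 2 * (G z).re) 0 t := by
        refine Real.circleAverage_mono hei hGre fun z hz => ?_
        have hcos : 1 / 2 ≤ Real.cos (σ * (F z).re) := by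
          have h1 : |σ * (F z).re| ≤ 1 := by
            rw [abs_mul, hσ]
            linarith [hre z (hsph hz)]
          have h2 := Real.one_sub_sq_div_two_le_cos (x := σ * (F z).re)
          have h3 := (sq_le_one_iff_abs_le_one _).2 h1
          linarith
        simp only [G, Complex.exp_re, hre', him', Real.cos_neg]
        nlinarith [Real.exp_pos (σ * (F z).im)]
    _ = 2 * Real.circleAverage (fun z => (G z).re) 0 t :=
        Real.circleAverage_fun_smul (a := (2 : ℝ)) (f := fun z => (G z).re)
    _ ≤ 2 := by
        rw [hmeanre]
        linarith

/-- Powers are dominated by exponentials, so exponential integrability of the imaginary part, for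
both signs `σ = ±1/2`, bounds every finite moment. -/
theorem exists_hardyNorm_le_of_abs_re_le (p : ℝ≥0∞) (hp0 : p ≠ 0) (hp : p ≠ ∞) :
    ∃ C : ℝ, 0 ≤ C ∧ ∀ F : ℂ → ℂ, DifferentiableOn ℂ F (Metric.ball 0 1) →
      (∀ z ∈ Metric.ball (0 : ℂ) 1, |(F z).re| ≤ 2) → (F 0).im = 0 →
      hardyNorm p F ≤ ENNReal.ofReal C := by
  set q := p.toReal with hq
  have hq0 : 0 < q := ENNReal.toReal_pos hp0 hp
  -- From `x ^ q ≤ (q / (1/2)) ^ q * exp (x / 2)` at `x = 2 + |Im F|`; the summand `2` yields the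
  -- factor `exp 1`.
  set K : ℝ := (q / |(1 / 2 : ℝ)|) ^ q * Real.exp 1 with hK
  have hK0 : 0 ≤ K := by positivity
  refine ⟨(K * 4) ^ q⁻¹, by positivity, fun F hF hre h0 => iSup₂_le fun t ht => ?_⟩
  have hsph := sphere_subset_unitBall ht
  have hFc := hF.continuousOn.mono hsph
  refine (circleLpNorm_le_ofReal_iff hp0 hp hFc (by positivity)).2 ?_
  rw [← hq, Real.rpow_inv_rpow (by positivity) hq0.ne']
  have hei : ∀ σ : ℝ, ContinuousOn (fun z => Real.exp (σ * (F z).im)) (Metric.sphere 0 |t|) :=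
    fun σ => Real.continuous_exp.comp_continuousOn
      (continuousOn_const.mul (Complex.continuous_im.comp_continuousOn hFc))
  have hint : ContinuousOn (fun z => ‖F z‖ ^ q) (Metric.sphere 0 |t|) :=
    hFc.norm.rpow_const fun _ _ => Or.inr hq0.le
  have hsum : ContinuousOn (fun z => Real.exp (1 / 2 * (F z).im) + Real.exp (-(1 / 2) * (F z).im))
      (Metric.sphere 0 |t|) := (hei _).add (hei _)
  calc Real.circleAverage (fun z => ‖F z‖ ^ q) 0 t
      ≤ Real.circleAverage (fun z => K * (Real.exp (1 / 2 * (F z).im) +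
          Real.exp (-(1 / 2) * (F z).im))) 0 t := by
        refine Real.circleAverage_mono hint.circleIntegrable'
          (continuousOn_const.mul hsum).circleIntegrable' fun z hz => ?_
        have h1 : ‖F z‖ ≤ 2 + |(F z).im| := (Complex.norm_le_abs_re_add_abs_im _).trans
          (by linarith [hre z (hsph hz)])
        have h2 := ProbabilityTheory.rpow_abs_le_mul_exp_abs (2 + |(F z).im|) hq0.le
          (by norm_num : (1 / 2 : ℝ) ≠ 0)
        have h3 : abs (2 + |(F z).im|) = 2 + |(F z).im| := abs_of_nonneg (by positivity)
        have h4 : Real.exp (1 / 2 * |(F z).im|) ≤ Real.exp (1 / 2 * (F z).im) +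
            Real.exp (-(1 / 2) * (F z).im) := by
          rcases abs_cases (F z).im with ⟨h, _⟩ | ⟨h, _⟩
          · rw [h]
            linarith [Real.exp_pos (-(1 / 2) * (F z).im)]
          · rw [h, mul_neg, ← neg_mul]
            linarith [Real.exp_pos (1 / 2 * (F z).im)]
        refine (Real.rpow_le_rpow (norm_nonneg _) h1 hq0.le).trans ?_
        rw [h3] at h2
        refine h2.trans ?_
        rw [hK, mul_assoc]
        gcongr
        rw [abs_of_pos (by norm_num : (0 : ℝ) < 1 / 2), mul_add, Real.exp_add]
        norm_num at h4 ⊢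
        gcongr
    _ = K * (Real.circleAverage (fun z => Real.exp (1 / 2 * (F z).im)) 0 t +
          Real.circleAverage (fun z => Real.exp (-(1 / 2) * (F z).im)) 0 t) := by
        rw [← Real.circleAverage_fun_add (hei _).circleIntegrable' (hei _).circleIntegrable']
        exact Real.circleAverage_fun_smul (a := K)
    _ ≤ K * (2 + 2) := by
        gcongr
        · exact circleAverage_exp_im_le hF hre h0 ht (by norm_num)
        · exact circleAverage_exp_im_le hF hre h0 ht (by norm_num)
    _ = K * 4 := by norm_num

/-! ### Sums of Cauchy kernels over one layer -/

theorem norm_layerPoint {r : ℕ → ℝ} (hr : ∀ k, 0 ≤ r k) (n : ℕ → ℕ) (k j : ℕ) :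
    ‖layerPoint r n k j‖ = r k := by
  have h : (2 * Real.pi * Complex.I * j / n k : ℂ) = ((2 * Real.pi * j / n k : ℝ) : ℂ) *
      Complex.I := by
    push_cast
    ring
  rw [layerPoint, norm_mul, h, Complex.norm_exp_ofReal_mul_I, mul_one, Complex.norm_real,
    Real.norm_of_nonneg (hr k)]

theorem one_sub_conj_mul_ne_zero {w z : ℂ} (hw : ‖w‖ < 1) (hz : z ∈ Metric.ball (0 : ℂ) 1) :
    1 - (starRingEnd ℂ) w * z ≠ 0 := by
  rw [mem_ball_zero_iff] at hz
  intro h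
  have h1 : ‖(starRingEnd ℂ) w * z‖ = 1 := by rw [← sub_eq_zero.1 h, norm_one]
  rw [norm_mul, RCLike.norm_conj] at h1
  exact (mul_lt_one_of_nonneg_of_lt_one_left (norm_nonneg _) hw hz.le).ne h1

theorem differentiableOn_cauchyKernel {w : ℂ} (hw : ‖w‖ < 1) :
    DifferentiableOn ℂ (cauchyKernel w) (Metric.ball 0 1) :=
  (differentiableOn_const _).div ((differentiableOn_const _).sub (differentiableOn_id.const_mul _))
    fun _ hz => one_sub_conj_mul_ne_zero hw hz

theorem memHardy_cauchyKernel (p : ℝ≥0∞) {w : ℂ} (hw : ‖w‖ < 1) : MemHardy p (cauchyKernel w) := by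
  refine ⟨differentiableOn_cauchyKernel hw, ?_⟩
  refine (hardyNorm_le_of_forall_norm_le (B := 1 / (1 - ‖w‖)) p fun z hz => ?_).trans_lt
    ENNReal.ofReal_lt_top
  rw [mem_ball_zero_iff] at hz
  rw [cauchyKernel, norm_div, norm_one]
  refine one_div_le_one_div_of_le (by linarith) ?_
  have h1 := norm_sub_norm_le 1 ((starRingEnd ℂ) w * z)
  rw [norm_one, norm_mul, RCLike.norm_conj] at h1
  have := mul_le_of_le_one_right (norm_nonneg w) hz.le
  linarith

theorem re_one_div_one_sub_nonneg {u : ℂ} (hu : ‖u‖ ≤ 1) : 0 ≤ (1 / (1 - u)).re := by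
  rw [one_div, Complex.inv_re]
  refine div_nonneg ?_ (Complex.normSq_nonneg _)
  simpa using (Complex.re_le_norm u).trans hu

theorem re_cauchyKernel_nonneg {w z : ℂ} (hw : ‖w‖ ≤ 1) (hz : z ∈ Metric.ball (0 : ℂ) 1) :
    0 ≤ (cauchyKernel w z).re := by
  rw [mem_ball_zero_iff] at hz
  refine re_one_div_one_sub_nonneg ?_
  rw [norm_mul, RCLike.norm_conj]
  exact mul_le_one₀ hw (norm_nonneg _) hz.le

/-- The combination of the Cauchy kernels of layer `k` with coefficients `c`. -/
noncomputable def layerSum (r : ℕ → ℝ) (n : ℕ → ℕ) (k : ℕ) (c : ℕ → ℂ) (z : ℂ) : ℂ :=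
  ∑ j ∈ Finset.range (n k), c j * cauchyKernel (layerPoint r n k j) z

theorem differentiableOn_layerSum {r : ℕ → ℝ} (hr : ∀ k, 0 ≤ r k ∧ r k < 1) (n : ℕ → ℕ) (k : ℕ)
    (c : ℕ → ℂ) : DifferentiableOn ℂ (layerSum r n k c) (Metric.ball 0 1) :=
  DifferentiableOn.fun_sum fun j _ => (differentiableOn_cauchyKernel
    ((norm_layerPoint (fun k => (hr k).1) n k j).trans_lt (hr k).2)).const_mul _

/-- The primitive root of unity `e^{2πi/n}`. -/
noncomputable def rootOfUnity (n : ℕ) : ℂ := Complex.exp (2 * Real.pi * Complex.I / n)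

theorem isPrimitiveRoot_rootOfUnity {n : ℕ} (hn : n ≠ 0) : IsPrimitiveRoot (rootOfUnity n) n :=
  Complex.isPrimitiveRoot_exp n hn

theorem norm_rootOfUnity_pow {n : ℕ} (hn : n ≠ 0) (j : ℕ) : ‖rootOfUnity n ^ j‖ = 1 := by
  rw [norm_pow, (isPrimitiveRoot_rootOfUnity hn).norm'_eq_one hn, one_pow]

theorem cauchyKernel_layerPoint (r : ℕ → ℝ) {n : ℕ → ℕ} (k j : ℕ) (hn : n k ≠ 0) (z : ℂ) :
    cauchyKernel (layerPoint r n k j) z =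
      1 / (1 - (rootOfUnity (n k) ^ j)⁻¹ * (r k * z)) := by
  have h : Complex.exp (2 * Real.pi * Complex.I * j / n k) = rootOfUnity (n k) ^ j := by
    rw [rootOfUnity, ← Complex.exp_nat_mul]
    congr 1
    ring
  rw [cauchyKernel, layerPoint, h, map_mul, Complex.conj_ofReal,
    ← Complex.inv_eq_conj (norm_rootOfUnity_pow hn j)]
  ring_nf

theorem sum_pow_rootOfUnity {n d m : ℕ} (hn : n ≠ 0) (hd : d < n) (hm : m < n) :
    ∑ j ∈ Finset.range n, (rootOfUnity n ^ j) ^ d * ((rootOfUnity n ^ j)⁻¹) ^ m =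
      if m = d then (n : ℂ) else 0 := by
  have hω := isPrimitiveRoot_rootOfUnity hn
  have hω0 : rootOfUnity n ≠ 0 := hω.ne_zero hn
  set x := rootOfUnity n ^ d * (rootOfUnity n ^ m)⁻¹ with hx
  have hterm : ∀ j, (rootOfUnity n ^ j) ^ d * ((rootOfUnity n ^ j)⁻¹) ^ m = x ^ j := fun j => by
    rw [hx, mul_pow, inv_pow, inv_pow, ← pow_mul, ← pow_mul, ← pow_mul, ← pow_mul, mul_comm j,
      mul_comm j]
  simp only [hterm]
  split_ifs with h
  · have : x = 1 := by
      rw [hx, h, mul_inv_cancel₀ (pow_ne_zero _ hω0)]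
    simp [this]
  · have hx1 : x ≠ 1 := fun h1 => h (hω.pow_inj hm hd
      (mul_inv_eq_one₀ (pow_ne_zero _ hω0) |>.1 h1).symm)
    have hxn : x ^ n = 1 := by
      rw [hx, mul_pow, inv_pow, ← pow_mul, ← pow_mul, mul_comm d, mul_comm m, pow_mul, pow_mul,
        hω.pow_eq_one]
      simp
    rw [geom_sum_eq hx1, hxn, sub_self, zero_div]

/-- With `w = r_k z` and `y = ω^{-j} w` one has `y^n = w^n`, so each kernel is the finite geometric
sum of `y` divided by the common factor `1 - w^n`. Orthogonality of the characters then keeps only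
the power `d`. -/
theorem layerSum_monomial (r : ℕ → ℝ) {n : ℕ → ℕ} (hr : ∀ k, 0 ≤ r k ∧ r k < 1) {k d : ℕ}
    (hd : d < n k) {z : ℂ} (hz : z ∈ Metric.ball (0 : ℂ) 1) :
    layerSum r n k (fun j => (rootOfUnity (n k) ^ j) ^ d / n k) z =
      (r k * z) ^ d / (1 - (r k * z) ^ n k) := by
  have hn : n k ≠ 0 := (Nat.zero_lt_of_lt hd).ne'
  set w : ℂ := r k * z with hw
  have hw1 : ‖w‖ < 1 := by
    rw [mem_ball_zero_iff] at hz
    rw [hw, norm_mul, Complex.norm_real, Real.norm_of_nonneg (hr k).1]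
    exact mul_lt_one_of_nonneg_of_lt_one_left (hr k).1 (hr k).2 hz.le
  have hwn : 1 - w ^ n k ≠ 0 := by
    intro h
    have h1 : ‖w ^ n k‖ = 1 := by rw [← sub_eq_zero.1 h, norm_one]
    rw [norm_pow] at h1
    exact (pow_lt_one₀ (norm_nonneg _) hw1 hn).ne h1
  have hgeom : ∀ j, cauchyKernel (layerPoint r n k j) z =
      (∑ m ∈ Finset.range (n k), ((rootOfUnity (n k) ^ j)⁻¹) ^ m * w ^ m) / (1 - w ^ n k) := by
    intro j
    rw [cauchyKernel_layerPoint r k j hn, ← hw]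
    set y := (rootOfUnity (n k) ^ j)⁻¹ * w with hy
    have hyn : y ^ n k = w ^ n k := by
      rw [hy, mul_pow, inv_pow, ← pow_mul, mul_comm j, pow_mul,
        (isPrimitiveRoot_rootOfUnity hn).pow_eq_one]
      simp
    have hy1 : 1 - y ≠ 0 := by
      intro h
      rw [← hyn, ← sub_eq_zero.1 h] at hwn
      simp at hwn
    rw [div_eq_div_iff hy1 hwn, one_mul, ← hyn]
    simp only [← mul_pow, ← hy]
    rw [geom_sum_mul_neg]
  have hn' : (n k : ℂ) ≠ 0 := Nat.cast_ne_zero.2 hn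
  calc layerSum r n k (fun j => (rootOfUnity (n k) ^ j) ^ d / n k) z
      = (∑ m ∈ Finset.range (n k), (∑ j ∈ Finset.range (n k), (rootOfUnity (n k) ^ j) ^ d *
          ((rootOfUnity (n k) ^ j)⁻¹) ^ m) * w ^ m) / (n k * (1 - w ^ n k)) := by
        simp only [layerSum, hgeom, Finset.sum_mul]
        rw [Finset.sum_comm, Finset.sum_div]
        refine Finset.sum_congr rfl fun j _ => ?_
        rw [div_mul_div_comm, Finset.mul_sum]
        simp only [mul_assoc]
    _ = (∑ m ∈ Finset.range (n k), if m = d then (n k : ℂ) * w ^ m else 0) /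
          (n k * (1 - w ^ n k)) := by
        congr 1
        refine Finset.sum_congr rfl fun m hm => ?_
        rw [sum_pow_rootOfUnity hn hd (Finset.mem_range.1 hm)]
        split_ifs <;> simp
    _ = w ^ d / (1 - w ^ n k) := by
        rw [Finset.sum_ite_eq' (Finset.range (n k)) d, if_pos (Finset.mem_range.2 hd),
          mul_div_mul_left _ _ hn']

theorem layerSum_polynomial (r : ℕ → ℝ) {n : ℕ → ℕ} (hr : ∀ k, 0 ≤ r k ∧ r k < 1) {k : ℕ}
    (g : Polynomial ℂ) (hg : g.natDegree < n k) {z : ℂ} (hz : z ∈ Metric.ball (0 : ℂ) 1) :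
    layerSum r n k (fun j => g.eval (rootOfUnity (n k) ^ j) / n k) z =
      g.eval (r k * z) / (1 - (r k * z) ^ n k) := by
  have h1 : layerSum r n k (fun j => g.eval (rootOfUnity (n k) ^ j) / n k) z =
      ∑ d ∈ Finset.range (g.natDegree + 1), g.coeff d *
        layerSum r n k (fun j => (rootOfUnity (n k) ^ j) ^ d / n k) z := by
    simp only [layerSum, Polynomial.eval_eq_sum_range, Finset.mul_sum, Finset.sum_div,
      Finset.sum_mul]
    rw [Finset.sum_comm]
    refine Finset.sum_congr rfl fun d _ => Finset.sum_congr rfl fun j _ => ?_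
    ring
  rw [h1, Polynomial.eval_eq_sum_range, Finset.sum_div]
  refine Finset.sum_congr rfl fun d hd => ?_
  rw [layerSum_monomial r hr ((Nat.lt_succ_iff.1 (Finset.mem_range.1 hd)).trans_lt hg) hz,
    mul_div_assoc]

/-- The only quantitative use of the density of the layers: `r_k ≤ e^{-(1 - r_k)}`, so the power is
at most `e^{-2}`. -/
theorem norm_mul_pow_le {r : ℕ → ℝ} {n : ℕ → ℕ} (hr : ∀ k, 0 ≤ r k ∧ r k < 1)
    (hM : ∀ k, 2 ≤ n k * (1 - r k)) (k : ℕ) {z : ℂ} (hz : z ∈ Metric.ball (0 : ℂ) 1) :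
    ‖((r k : ℂ) * z) ^ n k‖ ≤ 1 / 3 := by
  rw [mem_ball_zero_iff] at hz
  have h1 : ‖(r k : ℂ) * z‖ ≤ r k := by
    rw [norm_mul, Complex.norm_real, Real.norm_of_nonneg (hr k).1]
    exact mul_le_of_le_one_right (hr k).1 hz.le
  have h2 : r k ≤ Real.exp (-(1 - r k)) := by
    linarith [Real.add_one_le_exp (-(1 - r k))]
  have h3 : (3 : ℝ) ≤ Real.exp 2 := by linarith [Real.add_one_le_exp (2 : ℝ)]
  calc ‖((r k : ℂ) * z) ^ n k‖ = ‖(r k : ℂ) * z‖ ^ n k := norm_pow _ _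
    _ ≤ Real.exp (-(1 - r k)) ^ n k := pow_le_pow_left₀ (norm_nonneg _) (h1.trans h2) _
    _ = Real.exp (-(n k * (1 - r k))) := by
      rw [← Real.exp_nat_mul]
      congr 1
      ring
    _ ≤ Real.exp (-2) := Real.exp_le_exp.2 (neg_le_neg (hM k))
    _ ≤ 1 / 3 := by
      rw [Real.exp_neg, ← one_div]
      exact one_div_le_one_div_of_le (by norm_num) h3

theorem two_thirds_le_norm_one_sub {u : ℂ} (hu : ‖u‖ ≤ 1 / 3) : 2 / 3 ≤ ‖1 - u‖ := by
  have := norm_sub_norm_le 1 u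
  rw [norm_one] at this
  linarith

/-- The bound sees only the size of the coefficients, so it survives truncation of a layer at any
index. That is how partial sums ending inside a layer are handled. -/
theorem exists_hardyNorm_layerSum_le (p : ℝ≥0∞) (hp1 : 1 ≤ p) (hp : p ≠ ∞) :
    ∃ C : ℝ, 0 ≤ C ∧ ∀ (r : ℕ → ℝ) (n : ℕ → ℕ), (∀ k, 0 ≤ r k ∧ r k < 1) → (∀ k, 1 ≤ n k) →
      (∀ k, 2 ≤ n k * (1 - r k)) → ∀ (k : ℕ) (B : ℝ) (c : ℕ → ℂ), (∀ j, ‖c j‖ ≤ B) →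
      hardyNorm p (layerSum r n k fun j => c j / n k) ≤ ENNReal.ofReal (C * B) := by
  obtain ⟨C, hC0, hC⟩ := exists_hardyNorm_le_of_abs_re_le p (zero_lt_one.trans_le hp1).ne' hp
  refine ⟨4 * C, by positivity, fun r n hr hn hM k B c hc => ?_⟩
  have hB0 : 0 ≤ B := (norm_nonneg _).trans (hc 0)
  have hnk : n k ≠ 0 := Nat.one_le_iff_ne_zero.1 (hn k)
  have hlp : ∀ j, ‖layerPoint r n k j‖ < 1 := fun j =>
    (norm_layerPoint (fun k => (hr k).1) n k j).trans_lt (hr k).2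
  -- For coefficients in `[0, 1]`, positivity of the real parts of the kernels allows comparison
  -- with the case of all coefficients `1`, whose sum is explicit and bounded by `3/2`. The value at
  -- `0` is real because every kernel equals `1` there.
  have hunit : ∀ a : ℕ → ℝ, (∀ j, 0 ≤ a j ∧ a j ≤ 1) →
      hardyNorm p (layerSum r n k fun j => ((a j / n k : ℝ) : ℂ)) ≤ ENNReal.ofReal C := by
    intro a ha
    refine hC _ (differentiableOn_layerSum hr n k _) (fun z hz => ?_) ?_
    · have hre : (layerSum r n k (fun j => ((a j / n k : ℝ) : ℂ)) z).re =
          ∑ j ∈ Finset.range (n k), a j / n k * (cauchyKernel (layerPoint r n k j) z).re := by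
        simp [layerSum, Complex.re_sum, -Complex.ofReal_div]
      have hk : ∀ j, 0 ≤ (cauchyKernel (layerPoint r n k j) z).re := fun j =>
        re_cauchyKernel_nonneg (hlp j).le hz
      have h0 : 0 ≤ (layerSum r n k (fun j => ((a j / n k : ℝ) : ℂ)) z).re := by
        rw [hre]
        exact Finset.sum_nonneg fun j _ =>
          mul_nonneg (div_nonneg (ha j).1 (Nat.cast_nonneg _)) (hk j)
      rw [abs_of_nonneg h0, hre]
      have hone := layerSum_polynomial r hr (1 : Polynomial ℂ) (k := k) (n := n)
        (by simpa using Nat.pos_of_ne_zero hnk) hz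
      simp only [Polynomial.eval_one] at hone
      have hone' : ∑ j ∈ Finset.range (n k),
          1 / (n k : ℝ) * (cauchyKernel (layerPoint r n k j) z).re =
            (1 / (1 - ((r k : ℂ) * z) ^ n k)).re := by
        rw [← hone, layerSum, Complex.re_sum]
        refine Finset.sum_congr rfl fun j _ => ?_
        rw [← Complex.re_ofReal_mul]
        simp
      calc ∑ j ∈ Finset.range (n k), a j / n k * (cauchyKernel (layerPoint r n k j) z).re
          ≤ ∑ j ∈ Finset.range (n k),
            1 / (n k : ℝ) * (cauchyKernel (layerPoint r n k j) z).re := by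
            refine Finset.sum_le_sum fun j _ => mul_le_mul_of_nonneg_right ?_ (hk j)
            exact div_le_div_of_nonneg_right (ha j).2 (Nat.cast_nonneg _)
        _ ≤ ‖1 / (1 - ((r k : ℂ) * z) ^ n k)‖ := hone' ▸ Complex.re_le_norm _
        _ ≤ 1 / (2 / 3) := by
            rw [norm_div, norm_one]
            exact one_div_le_one_div_of_le (by norm_num)
              (two_thirds_le_norm_one_sub (norm_mul_pow_le hr hM k hz))
        _ ≤ 2 := by norm_num
    · have : layerSum r n k (fun j => ((a j / n k : ℝ) : ℂ)) 0 =
          ((∑ j ∈ Finset.range (n k), a j / n k : ℝ) : ℂ) := by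
        simp [layerSum, cauchyKernel]
      rw [this, Complex.ofReal_im]
  have hpos : ∀ x : ℕ → ℝ, (∀ j, |x j| ≤ B) →
      hardyNorm p (layerSum r n k fun j => ((max (x j) 0 / n k : ℝ) : ℂ)) ≤
        ENNReal.ofReal (C * B) := by
    intro x hx
    have h1 := hunit (fun j => max (x j) 0 / B) fun j =>
      ⟨by positivity, div_le_one_of_le₀ (max_le ((le_abs_self _).trans (hx j)) hB0) hB0⟩
    have h2 : hardyNorm p (layerSum r n k fun j => ((max (x j) 0 / n k : ℝ) : ℂ)) =
        ENNReal.ofReal B *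
          hardyNorm p (layerSum r n k fun j => ((max (x j) 0 / B / n k : ℝ) : ℂ)) := by
      have h3 := hardyNorm_const_mul p (B : ℂ)
        (layerSum r n k fun j => ((max (x j) 0 / B / n k : ℝ) : ℂ))
      rw [Complex.norm_real, Real.norm_of_nonneg hB0] at h3
      rw [← h3]
      refine hardyNorm_congr p fun z _ => ?_
      simp only [layerSum, Finset.mul_sum]
      refine Finset.sum_congr rfl fun j _ => ?_
      rw [← mul_assoc, ← Complex.ofReal_mul]
      congr 2
      -- For `B = 0` the division by `B` is degenerate, but then all coefficients vanish.
      rcases hB0.eq_or_lt with h | h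
      · have h4 : max (x j) 0 = 0 := max_eq_right (by
          rw [h]
          exact (le_abs_self _).trans (hx j))
        simp [h4]
      · field_simp
    rw [h2, mul_comm C, ENNReal.ofReal_mul hB0]
    gcongr
  have hre : ∀ j, |(c j).re| ≤ B := fun j => (Complex.abs_re_le_norm _).trans (hc j)
  have him : ∀ j, |(c j).im| ≤ B := fun j => (Complex.abs_im_le_norm _).trans (hc j)
  have h1 := hpos (fun j => (c j).re) hre
  have h2 := hpos (fun j => -(c j).re) fun j => by simpa using hre j
  have h3 := hpos (fun j => (c j).im) him
  have h4 := hpos (fun j => -(c j).im) fun j => by simpa using him j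
  have hd := fun c => differentiableOn_layerSum hr n k c
  have h12 := (hardyNorm_sub_le hp1 (hd _) (hd _)).trans (add_le_add h1 h2)
  have h34 := (hardyNorm_sub_le hp1 (hd _) (hd _)).trans (add_le_add h3 h4)
  have h34' := (hardyNorm_const_mul p Complex.I _).trans_le (mul_le_mul_right h34 _)
  rw [Complex.norm_I, ENNReal.ofReal_one, one_mul] at h34'
  have hall := (hardyNorm_add_le hp1 ((hd _).sub (hd _)) (((hd _).sub (hd _)).const_mul _)).trans
    (add_le_add h12 h34')
  have hCB : 0 ≤ C * B := by positivity
  rw [← ENNReal.ofReal_add hCB hCB, ← ENNReal.ofReal_add (by positivity) (by positivity)] at hall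
  refine (hardyNorm_congr p fun z _ => ?_).trans_le (hall.trans_eq (congrArg _ (by ring)))
  simp only [layerSum, Pi.sub_apply, Finset.mul_sum, ← Finset.sum_sub_distrib,
    ← Finset.sum_add_distrib]
  refine Finset.sum_congr rfl fun j _ => ?_
  -- Positive and negative parts of the real and imaginary parts: four nonnegative pieces, hence the
  -- constant `4 * C`.
  have hdec : c j = ((max (c j).re 0 : ℝ) - (max (-(c j).re) 0 : ℝ) : ℂ) +
      Complex.I * ((max (c j).im 0 : ℝ) - (max (-(c j).im) 0 : ℝ)) := by
    have hx : ∀ x : ℝ, max x 0 - max (-x) 0 = x := fun x => by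
      rcases le_total x 0 with h | h <;> simp [h]
    rw [← Complex.ofReal_sub, ← Complex.ofReal_sub, hx, hx, mul_comm, Complex.re_add_im]
  conv_lhs => rw [hdec]
  push_cast
  ring

/-! ### Approximation by layers -/

theorem hardyNorm_add_le_ofReal {f g : ℂ → ℂ} {p : ℝ≥0∞} (hp : 1 ≤ p)
    (hf : DifferentiableOn ℂ f (Metric.ball 0 1)) (hg : DifferentiableOn ℂ g (Metric.ball 0 1))
    {a b : ℝ} (ha : 0 ≤ a) (hb : 0 ≤ b) (hfa : hardyNorm p f ≤ ENNReal.ofReal a)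
    (hgb : hardyNorm p g ≤ ENNReal.ofReal b) :
    hardyNorm p (fun z => f z + g z) ≤ ENNReal.ofReal (a + b) := by
  rw [ENNReal.ofReal_add ha hb]
  exact (hardyNorm_add_le hp hf hg).trans (add_le_add hfa hgb)

theorem hardyNorm_sub_le_ofReal {f g : ℂ → ℂ} {p : ℝ≥0∞} (hp : 1 ≤ p)
    (hf : DifferentiableOn ℂ f (Metric.ball 0 1)) (hg : DifferentiableOn ℂ g (Metric.ball 0 1))
    {a b : ℝ} (ha : 0 ≤ a) (hb : 0 ≤ b) (hfa : hardyNorm p f ≤ ENNReal.ofReal a)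
    (hgb : hardyNorm p g ≤ ENNReal.ofReal b) :
    hardyNorm p (fun z => f z - g z) ≤ ENNReal.ofReal (a + b) := by
  rw [ENNReal.ofReal_add ha hb]
  exact (hardyNorm_sub_le hp hf hg).trans (add_le_add hfa hgb)

theorem hardyNorm_sum_le_ofReal {s : Finset ℕ} {L : ℕ} (hs : s.card ≤ L) {f : ℕ → ℂ → ℂ}
    {p : ℝ≥0∞} (hp : 1 ≤ p) (hf : ∀ i ∈ s, DifferentiableOn ℂ (f i) (Metric.ball 0 1)) {a : ℝ}
    (hfa : ∀ i ∈ s, hardyNorm p (f i) ≤ ENNReal.ofReal a) :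
    hardyNorm p (fun z => ∑ i ∈ s, f i z) ≤ ENNReal.ofReal (L * a) := by
  refine (hardyNorm_sum_le s hp hf).trans ((Finset.sum_le_card_nsmul s _ _ hfa).trans ?_)
  rw [nsmul_eq_mul, ENNReal.ofReal_mul (Nat.cast_nonneg _), ENNReal.ofReal_natCast]
  gcongr

/-- With `u = (r_k z)^{n_k}` the difference is `(g(z) - g(r_k z)) / (1 - u) - g(z) u / (1 - u)`.
Since `|u| ≤ 1/3`, the multipliers satisfy `|1 / (1 - u)| ≤ 2` and `|u / (1 - u)| ≤ 1/2` pointwise.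
-/
theorem hardyNorm_layerSum_sub_polynomial_le {r : ℕ → ℝ} {n : ℕ → ℕ}
    (hr : ∀ k, 0 ≤ r k ∧ r k < 1) (hM : ∀ k, 2 ≤ n k * (1 - r k)) {p : ℝ≥0∞} (hp : 1 ≤ p)
    {g : Polynomial ℂ} {k : ℕ} (hg : g.natDegree < n k) {δ A : ℝ} (hδ : 0 ≤ δ) (hA : 0 ≤ A)
    (hgδ : ∀ z ∈ Metric.ball (0 : ℂ) 1, ‖g.eval (r k * z) - g.eval z‖ ≤ δ)
    (hgA : hardyNorm p (fun z => g.eval z) ≤ ENNReal.ofReal A) :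
    hardyNorm p (fun z => g.eval z -
      layerSum r n k (fun j => g.eval (rootOfUnity (n k) ^ j) / n k) z) ≤
        ENNReal.ofReal (2 * δ + 1 / 2 * A) := by
  have hne : ∀ z ∈ Metric.ball (0 : ℂ) 1, 1 - ((r k : ℂ) * z) ^ n k ≠ 0 := fun z hz h => by
    have := two_thirds_le_norm_one_sub (norm_mul_pow_le hr hM k hz)
    rw [h, norm_zero] at this
    linarith
  have hgd : DifferentiableOn ℂ (fun z => g.eval z) (Metric.ball 0 1) :=
    g.differentiable.differentiableOn
  have hlin : DifferentiableOn ℂ (fun z : ℂ => (r k : ℂ) * z) (Metric.ball 0 1) :=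
    differentiableOn_id.const_mul _
  have hgr : DifferentiableOn ℂ (fun z : ℂ => g.eval (r k * z)) (Metric.ball 0 1) :=
    g.differentiable.comp_differentiableOn hlin
  have hden : DifferentiableOn ℂ (fun z : ℂ => 1 - ((r k : ℂ) * z) ^ n k) (Metric.ball 0 1) :=
    (differentiableOn_const _).sub (hlin.pow _)
  have h1 : hardyNorm p (fun z => (g.eval z - g.eval (r k * z)) / (1 - ((r k : ℂ) * z) ^ n k)) ≤
      ENNReal.ofReal (2 * δ) := by
    refine hardyNorm_le_of_forall_norm_le p fun z hz => ?_
    have h2 := two_thirds_le_norm_one_sub (norm_mul_pow_le hr hM k hz)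
    rw [norm_div, norm_sub_rev, div_le_iff₀ (by linarith)]
    nlinarith [hgδ z hz]
  have h2 : hardyNorm p (fun z => g.eval z * (((r k : ℂ) * z) ^ n k /
      (1 - ((r k : ℂ) * z) ^ n k))) ≤ ENNReal.ofReal (1 / 2 * A) := by
    have h3 := hardyNorm_const_mul p ((1 / 2 : ℝ) : ℂ) fun z => g.eval z
    rw [Complex.norm_real, Real.norm_of_nonneg (by norm_num)] at h3
    rw [ENNReal.ofReal_mul (by norm_num)]
    refine le_trans (hardyNorm_mono p fun z hz => ?_) (h3.trans_le (by gcongr))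
    have h4 := norm_mul_pow_le hr hM k hz
    have h5 := two_thirds_le_norm_one_sub h4
    rw [norm_mul, norm_mul, Complex.norm_real, Real.norm_of_nonneg (by norm_num), mul_comm]
    refine mul_le_mul_of_nonneg_right ?_ (norm_nonneg _)
    rw [norm_div, div_le_iff₀ (by linarith)]
    linarith
  refine (hardyNorm_congr p fun z hz => ?_).trans_le (hardyNorm_sub_le_ofReal hp
    ((hgd.sub hgr).div hden hne) (hgd.mul ((hlin.pow _).div hden hne)) (by positivity)
    (by positivity) h1 h2)
  rw [layerSum_polynomial r hr g hg hz]
  have := hne z hz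
  simp only [Pi.sub_apply, Pi.mul_apply, Pi.div_apply, Pi.pow_apply]
  field_simp
  ring

theorem eventually_polynomial_dilation_close {r : ℕ → ℝ} (hr : ∀ k, 0 ≤ r k ∧ r k < 1)
    (hr1 : Tendsto r atTop (𝓝 1)) (g : Polynomial ℂ) {δ : ℝ} (hδ : 0 < δ) :
    ∀ᶠ k in atTop, ∀ z ∈ Metric.ball (0 : ℂ) 1, ‖g.eval (r k * z) - g.eval z‖ ≤ δ := by
  have hu : UniformContinuousOn (fun z => g.eval z) (Metric.closedBall (0 : ℂ) 1) :=
    (isCompact_closedBall _ _).uniformContinuousOn_of_continuous g.continuous.continuousOn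
  obtain ⟨η, hη, h⟩ := Metric.uniformContinuousOn_iff.1 hu δ hδ
  filter_upwards [hr1.eventually_const_lt (show 1 - η < 1 by linarith)] with k hk z hz
  rw [mem_ball_zero_iff] at hz
  rw [← dist_eq_norm]
  refine (h _ ?_ _ ?_ ?_).le
  · rw [mem_closedBall_zero_iff, norm_mul, Complex.norm_real, Real.norm_of_nonneg (hr k).1]
    exact mul_le_one₀ (hr k).2.le (norm_nonneg _) hz.le
  · exact mem_closedBall_zero_iff.2 hz.le
  · rw [dist_eq_norm, show (r k : ℂ) * z - z = ((r k - 1 : ℝ) : ℂ) * z by push_cast; ring,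
      norm_mul, Complex.norm_real, Real.norm_eq_abs, abs_sub_comm,
      abs_of_nonneg (by linarith [hr k])]
    have := mul_le_of_le_one_right (show 0 ≤ 1 - r k by linarith [hr k]) hz.le
    linarith

theorem eventually_lt_layer_card {r : ℕ → ℝ} {n : ℕ → ℕ} (hr : ∀ k, 0 ≤ r k ∧ r k < 1)
    (hr1 : Tendsto r atTop (𝓝 1)) (hM : ∀ k, 2 ≤ n k * (1 - r k)) (D : ℕ) :
    ∀ᶠ k in atTop, D < n k := by
  have hpos : (0 : ℝ) < 1 / (D + 1) := by positivity
  filter_upwards [hr1.eventually_const_lt (show 1 - 1 / ((D : ℝ) + 1) < 1 by linarith)] with k hk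
  by_contra! hle
  have h1 : (n k : ℝ) * (1 - r k) ≤ (D + 1) * (1 / (D + 1)) := by
    have : (n k : ℝ) ≤ D := by exact_mod_cast hle
    refine mul_le_mul (by linarith) (by linarith) (by linarith [hr k]) (by positivity)
  rw [mul_one_div_cancel (by positivity)] at h1
  linarith [hM k]

/-- The truncation of a coefficient sequence to its first `J` entries. -/
noncomputable def truncCoeff (J : ℕ) (c : ℕ → ℂ) (j : ℕ) : ℂ := if j < J then c j else 0

theorem norm_truncCoeff_le (J : ℕ) (c : ℕ → ℂ) (j : ℕ) : ‖truncCoeff J c j‖ ≤ ‖c j‖ := by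
  unfold truncCoeff
  split_ifs <;> simp

theorem layerSum_const_mul (r : ℕ → ℝ) (n : ℕ → ℕ) (k : ℕ) (a : ℂ) (c : ℕ → ℂ) (z : ℂ) :
    layerSum r n k (fun j => a * c j) z = a * layerSum r n k c z := by
  simp only [layerSum, Finset.mul_sum, mul_assoc]

theorem layerSum_zero (r : ℕ → ℝ) (n : ℕ → ℕ) (k : ℕ) (z : ℂ) :
    layerSum r n k (fun _ => 0) z = 0 := by
  simp [layerSum]

/-- The same approximant of a polynomial `g` close to `f` is taken on `L` layers and averaged. The
average is as good as each of its terms, complete layers contribute a fraction of `2 A`, and the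
incomplete one at most `A` by the choice of `L`. With `‖f‖ ≤ A` this gives `4 A` for intermediate
sums. -/
theorem exists_layers_approximation {r : ℕ → ℝ} {n : ℕ → ℕ} (hr : ∀ k, 0 ≤ r k ∧ r k < 1)
    (hr1 : Tendsto r atTop (𝓝 1)) (hn : ∀ k, 1 ≤ n k) (hM : ∀ k, 2 ≤ n k * (1 - r k))
    {p : ℝ≥0∞} (hp1 : 1 < p) (hp : p < ∞) {f : ℂ → ℂ}
    (hf : DifferentiableOn ℂ f (Metric.ball 0 1)) {A : ℝ} (hA : 0 < A)
    (hfA : hardyNorm p f ≤ ENNReal.ofReal A) (K₀ : ℕ) :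
    ∃ K₁ > K₀, ∃ b : ℕ → ℕ → ℂ,
      hardyNorm p (fun z => f z - ∑ k ∈ Finset.Ico K₀ K₁, layerSum r n k (b k) z) ≤
        ENNReal.ofReal (7 / 8 * A) ∧
      ∀ κ, κ < K₁ → ∀ J,
        hardyNorm p (fun z => f z - (∑ k ∈ Finset.Ico K₀ κ, layerSum r n k (b k) z +
          layerSum r n κ (truncCoeff J (b κ)) z)) ≤ ENNReal.ofReal (4 * A) := by
  obtain ⟨g, hg⟩ := MemHardy.exists_polynomial hp1 hp ⟨hf, hfA.trans_lt ENNReal.ofReal_lt_top⟩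
    (show 0 < A / 8 by positivity)
  obtain ⟨C, hC0, hC⟩ := exists_hardyNorm_layerSum_le p hp1.le hp.ne
  have hgd : DifferentiableOn ℂ (fun z => g.eval z) (Metric.ball 0 1) :=
    g.differentiable.differentiableOn
  have hgA : hardyNorm p (fun z => g.eval z) ≤ ENNReal.ofReal (A + A / 8) :=
    (hardyNorm_congr p fun z _ => by simp).trans_le
      (hardyNorm_sub_le_ofReal hp1.le hf (hf.sub hgd) hA.le (by positivity) hfA hg)
  obtain ⟨B, hB⟩ := (isCompact_sphere (0 : ℂ) 1).exists_bound_of_continuousOn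
    g.continuous.continuousOn
  have hB' : ∀ k j, ‖g.eval (rootOfUnity (n k) ^ j)‖ ≤ B := fun k j => hB _ (by
    rw [mem_sphere_zero_iff_norm]
    exact norm_rootOfUnity_pow (Nat.one_le_iff_ne_zero.1 (hn k)) j)
  have hB0 : 0 ≤ B := (norm_nonneg _).trans (hB' 0 0)
  obtain ⟨K, hK⟩ := eventually_atTop.1
    ((eventually_polynomial_dilation_close hr hr1 g (show 0 < A / 16 by positivity)).and
      ((eventually_lt_layer_card hr hr1 hM g.natDegree).and (eventually_ge_atTop K₀)))
  have hKK : K₀ ≤ K := (hK K le_rfl).2.2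
  -- Large enough for `C * (B / L) ≤ A`; the `+ 1` ensures `L ≥ 1`. As `B` depends on `g`, `L` can
  -- be chosen only after `g`.
  obtain ⟨L, hL⟩ := exists_nat_ge (C * B / A + 1)
  have hL1 : (1 : ℝ) ≤ L := le_trans (by
    have : 0 ≤ C * B / A := by positivity
    linarith) hL
  have hL0 : (0 : ℝ) < L := by linarith
  have hCB : C * (B / L) ≤ A := by
    rw [← mul_div_assoc, div_le_iff₀ hL0]
    have : C * B / A ≤ L := by linarith
    rw [div_le_iff₀ hA] at this
    linarith
  let a : ℕ → ℕ → ℂ := fun k j => g.eval (rootOfUnity (n k) ^ j) / n k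
  -- Layers from `K₀` up to `K`, too coarse for `g`, are skipped by giving them zero coefficients.
  let b : ℕ → ℕ → ℂ := fun k j => if K ≤ k then (L : ℂ)⁻¹ * a k j else 0
  have hT : ∀ k, DifferentiableOn ℂ (layerSum r n k (a k)) (Metric.ball 0 1) := fun k =>
    differentiableOn_layerSum hr n k _
  -- Here `11/16 = 2 * (1/16) + (1/2) * (9/8)`. Adding the error `A / 8` of `g` gives `13/16`, below
  -- the required `7/8`.
  have hclose : ∀ k, K ≤ k → hardyNorm p (fun z => g.eval z - layerSum r n k (a k) z) ≤
      ENNReal.ofReal (11 / 16 * A) := fun k hk =>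
    (hardyNorm_layerSum_sub_polynomial_le hr hM hp1.le (hK k hk).2.1 (by positivity)
      (by positivity) (hK k hk).1 hgA).trans_eq (congrArg _ (by ring))
  have hTA : ∀ k, K ≤ k → hardyNorm p (layerSum r n k (a k)) ≤ ENNReal.ofReal (2 * A) := by
    intro k hk
    refine (hardyNorm_congr p fun z _ => ?_).trans_le ((hardyNorm_sub_le_ofReal hp1.le hgd
      (hgd.sub (hT k)) (by positivity) (by positivity) hgA (hclose k hk)).trans
        (ENNReal.ofReal_le_ofReal (by linarith)))
    simp
  have hscale : ∀ (h : ℂ → ℂ) (x : ℝ), hardyNorm p h ≤ ENNReal.ofReal x →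
      hardyNorm p (fun z => (L : ℂ)⁻¹ * h z) ≤ ENNReal.ofReal ((L : ℝ)⁻¹ * x) := by
    intro h x hx
    rw [hardyNorm_const_mul, norm_inv, Complex.norm_natCast, ENNReal.ofReal_mul (by positivity)]
    gcongr
  have hsum : ∀ κ z, ∑ k ∈ Finset.Ico K₀ κ, layerSum r n k (b k) z =
      ∑ k ∈ Finset.Ico K κ, (L : ℂ)⁻¹ * layerSum r n k (a k) z := by
    intro κ z
    symm
    rw [← Finset.sum_subset (Finset.Ico_subset_Ico_left (b := κ) hKK) fun k hk hk' => ?_]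
    · refine Finset.sum_congr rfl fun k hk => ?_
      rw [← layerSum_const_mul]
      simp only [b, if_pos (Finset.mem_Ico.1 hk).1]
    · have : ¬ K ≤ k := fun h => hk' (Finset.mem_Ico.2 ⟨h, (Finset.mem_Ico.1 hk).2⟩)
      simp only [b, if_neg this, layerSum_zero]
  have hcard : (Finset.Ico K (K + L)).card ≤ L := by simp
  have hLL : (L : ℝ) * (L : ℝ)⁻¹ = 1 := mul_inv_cancel₀ hL0.ne'
  have hLL' : (L : ℂ) * (L : ℂ)⁻¹ = 1 := mul_inv_cancel₀ fun h => hL0.ne' (by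
    rw [Nat.cast_eq_zero] at h
    rw [h, Nat.cast_zero])
  refine ⟨K + L, ?_, b, ?_, fun κ hκ J => ?_⟩
  · have : 1 ≤ L := by exact_mod_cast hL1
    omega
  · have h1 : hardyNorm p (fun z => ∑ k ∈ Finset.Ico K (K + L),
        (L : ℂ)⁻¹ * (g.eval z - layerSum r n k (a k) z)) ≤
          ENNReal.ofReal (L * ((L : ℝ)⁻¹ * (11 / 16 * A))) :=
      hardyNorm_sum_le_ofReal hcard hp1.le (fun k _ => (hgd.sub (hT k)).const_mul _)
        fun k hk => hscale _ _ (hclose k (Finset.mem_Ico.1 hk).1)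
    rw [← mul_assoc, hLL, one_mul] at h1
    refine (hardyNorm_congr p fun z _ => ?_).trans_le ((hardyNorm_add_le_ofReal hp1.le
      (hf.sub hgd) (DifferentiableOn.fun_sum fun k _ => (hgd.sub (hT k)).const_mul _)
      (by positivity) (by positivity) hg h1).trans (ENNReal.ofReal_le_ofReal (by linarith)))
    rw [hsum]
    simp only [Pi.sub_apply, mul_sub, Finset.sum_sub_distrib, Finset.sum_const, Nat.card_Ico,
      nsmul_eq_mul, add_tsub_cancel_left]
    rw [← mul_assoc, hLL', one_mul]
    ring
  · have h1 : hardyNorm p (fun z => ∑ k ∈ Finset.Ico K κ,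
        (L : ℂ)⁻¹ * layerSum r n k (a k) z) ≤ ENNReal.ofReal (L * ((L : ℝ)⁻¹ * (2 * A))) :=
      hardyNorm_sum_le_ofReal (by rw [Nat.card_Ico]; omega) hp1.le (fun k _ => (hT k).const_mul _)
        fun k hk => hscale _ _ (hTA k (Finset.mem_Ico.1 hk).1)
    rw [← mul_assoc, hLL, one_mul] at h1
    have h2 : hardyNorm p (layerSum r n κ (truncCoeff J (b κ))) ≤ ENNReal.ofReal A := by
      have hnk : (n κ : ℂ) ≠ 0 := Nat.cast_ne_zero.2 (Nat.one_le_iff_ne_zero.1 (hn κ))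
      have h3 := hC r n hr hn hM κ (B / L)
        (truncCoeff J fun j => if K ≤ κ then (L : ℂ)⁻¹ * g.eval (rootOfUnity (n κ) ^ j) else 0)
        fun j => by
          refine (norm_truncCoeff_le _ _ _).trans ?_
          split_ifs
          · rw [norm_mul, norm_inv, Complex.norm_natCast, div_eq_inv_mul]
            exact mul_le_mul_of_nonneg_left (hB' κ j) (by positivity)
          · simpa using div_nonneg hB0 hL0.le
      refine (hardyNorm_congr p fun z _ => ?_).trans_le
        (h3.trans (ENNReal.ofReal_le_ofReal hCB))
      congr 1
      funext j
      simp only [truncCoeff, b, a]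
      split_ifs <;> simp [mul_div_assoc]
    have hd1 : DifferentiableOn ℂ (fun z => ∑ k ∈ Finset.Ico K κ,
        (L : ℂ)⁻¹ * layerSum r n k (a k) z) (Metric.ball 0 1) :=
      DifferentiableOn.fun_sum fun k _ => (hT k).const_mul _
    have hd2 := differentiableOn_layerSum hr n κ (truncCoeff J (b κ))
    have h4 := hardyNorm_add_le_ofReal hp1.le hd1 hd2 (by positivity) hA.le h1 h2
    refine (hardyNorm_congr p fun z _ => ?_).trans_le ((hardyNorm_sub_le_ofReal hp1.le hf
      (hd1.add hd2) hA.le (by positivity) hfA h4).trans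
        (ENNReal.ofReal_le_ofReal (by linarith)))
    simp only [hsum, Pi.add_apply]

/-! ### The representing system -/

/-- The sum over the layers before layer `κ` of the kernels with coefficients `b`. -/
noncomputable def layersSum (r : ℕ → ℝ) (n : ℕ → ℕ) (b : ℕ → ℕ → ℂ) (κ : ℕ) (z : ℂ) : ℂ :=
  ∑ k ∈ Finset.range κ, layerSum r n k (b k) z

theorem differentiableOn_layersSum {r : ℕ → ℝ} (hr : ∀ k, 0 ≤ r k ∧ r k < 1) (n : ℕ → ℕ)
    (b : ℕ → ℕ → ℂ) (κ : ℕ) : DifferentiableOn ℂ (layersSum r n b κ) (Metric.ball 0 1) :=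
  DifferentiableOn.fun_sum fun k _ => differentiableOn_layerSum hr n k (b k)

theorem layersSum_congr (r : ℕ → ℝ) (n : ℕ → ℕ) {b b' : ℕ → ℕ → ℂ} {κ : ℕ}
    (h : ∀ k < κ, b k = b' k) (z : ℂ) : layersSum r n b κ z = layersSum r n b' κ z :=
  Finset.sum_congr rfl fun k hk => by rw [h k (Finset.mem_range.1 hk)]

theorem exists_layers_extension {r : ℕ → ℝ} {n : ℕ → ℕ} (hr : ∀ k, 0 ≤ r k ∧ r k < 1)
    (hr1 : Tendsto r atTop (𝓝 1)) (hn : ∀ k, 1 ≤ n k) (hM : ∀ k, 2 ≤ n k * (1 - r k))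
    {p : ℝ≥0∞} (hp1 : 1 < p) (hp : p < ∞) {f : ℂ → ℂ}
    (hf : DifferentiableOn ℂ f (Metric.ball 0 1)) {A : ℝ} (hA : 0 < A) (K : ℕ) (b : ℕ → ℕ → ℂ)
    (hfA : hardyNorm p (fun z => f z - layersSum r n b K z) ≤ ENNReal.ofReal A) :
    ∃ K' > K, ∃ b' : ℕ → ℕ → ℂ, (∀ k < K, b' k = b k) ∧
      hardyNorm p (fun z => f z - layersSum r n b' K' z) ≤ ENNReal.ofReal (7 / 8 * A) ∧
      ∀ κ, K ≤ κ → κ < K' → ∀ J,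
        hardyNorm p (fun z => f z - (layersSum r n b' κ z +
          layerSum r n κ (truncCoeff J (b' κ)) z)) ≤ ENNReal.ofReal (4 * A) := by
  obtain ⟨K', hK', c, h1, h2⟩ := exists_layers_approximation hr hr1 hn hM hp1 hp
    (hf.sub (differentiableOn_layersSum hr n b K)) hA hfA K
  let b' : ℕ → ℕ → ℂ := fun k => if k < K then b k else c k
  have hb' : ∀ k < K, b' k = b k := fun k hk => if_pos hk
  have hbc : ∀ k, K ≤ k → b' k = c k := fun k hk => if_neg (not_lt.2 hk)
  have hsplit : ∀ κ, K ≤ κ → ∀ z, layersSum r n b' κ z =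
      layersSum r n b K z + ∑ k ∈ Finset.Ico K κ, layerSum r n k (c k) z := by
    intro κ hκ z
    rw [← layersSum_congr r n hb', layersSum, layersSum, ← Finset.sum_range_add_sum_Ico _ hκ]
    refine congrArg₂ _ rfl (Finset.sum_congr rfl fun k hk => ?_)
    rw [hbc k (Finset.mem_Ico.1 hk).1]
  refine ⟨K', hK', b', hb', (hardyNorm_congr p fun z _ => ?_).trans_le h1,
    fun κ hκ hκ' J => (hardyNorm_congr p fun z _ => ?_).trans_le (h2 κ hκ' J)⟩
  · rw [hsplit K' hK'.le, Pi.sub_apply]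
    ring
  · rw [hsplit κ hκ, hbc κ hκ, Pi.sub_apply]
    ring

/-- Stage `s` starts from a remainder of norm at most `A s`, and every partial sum during it leaves
at most `4 * A s`. Coefficients of earlier layers are never altered, so the stages fit together, and
the errors tend to `0` geometrically. -/
theorem exists_layer_coefficients {r : ℕ → ℝ} {n : ℕ → ℕ} (hr : ∀ k, 0 ≤ r k ∧ r k < 1)
    (hr1 : Tendsto r atTop (𝓝 1)) (hn : ∀ k, 1 ≤ n k) (hM : ∀ k, 2 ≤ n k * (1 - r k))
    {p : ℝ≥0∞} (hp1 : 1 < p) (hp : p < ∞) {f : ℂ → ℂ} (hf : MemHardy p f) :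
    ∃ b : ℕ → ℕ → ℂ, ∀ ε : ℝ≥0∞, 0 < ε → ∃ K : ℕ, ∀ κ ≥ K, ∀ J,
      hardyNorm p (fun z => f z - (layersSum r n b κ z +
        layerSum r n κ (truncCoeff J (b κ)) z)) ≤ ε := by
  -- The `+ 1` keeps the bound positive when `f = 0`.
  set A₀ : ℝ := (hardyNorm p f).toReal + 1 with hA₀
  have hA₀pos : 0 < A₀ := by positivity
  let A : ℕ → ℝ := fun s => (7 / 8) ^ s * A₀
  have hApos : ∀ s, 0 < A s := fun s => by positivity
  let P : ℕ → ℕ × (ℕ → ℕ → ℂ) → Prop := fun s x =>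
    hardyNorm p (fun z => f z - layersSum r n x.2 x.1 z) ≤ ENNReal.ofReal (A s)
  have hstep : ∀ (s : ℕ) (x : ℕ × (ℕ → ℕ → ℂ)), ∃ y : ℕ × (ℕ → ℕ → ℂ), P s x →
      x.1 < y.1 ∧ (∀ k < x.1, y.2 k = x.2 k) ∧ P (s + 1) y ∧
      ∀ κ, x.1 ≤ κ → κ < y.1 → ∀ J,
        hardyNorm p (fun z => f z - (layersSum r n y.2 κ z +
          layerSum r n κ (truncCoeff J (y.2 κ)) z)) ≤ ENNReal.ofReal (4 * A s) := by
    intro s x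
    by_cases hx : P s x
    · obtain ⟨K', h1, b', h2, h3, h4⟩ :=
        exists_layers_extension hr hr1 hn hM hp1 hp hf.1 (hApos s) x.1 x.2 hx
      refine ⟨(K', b'), fun _ => ⟨h1, h2, h3.trans_eq (congrArg _ ?_), h4⟩⟩
      simp only [A, pow_succ]
      ring
    -- A dummy successor for states violating the invariant; the recursion never reaches one.
    · exact ⟨x, fun h => absurd h hx⟩
  choose next hnext using hstep
  let x : ℕ → ℕ × (ℕ → ℕ → ℂ) := fun s => Nat.rec (0, fun _ _ => 0) next s
  have hxs : ∀ s, x (s + 1) = next s (x s) := fun _ => rfl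
  have hP : ∀ s, P s (x s) := by
    intro s
    induction s with
    | zero =>
      have h1 : hardyNorm p (fun z => f z - layersSum r n (x 0).2 (x 0).1 z) = hardyNorm p f :=
        hardyNorm_congr p fun z _ => by simp [x, layersSum]
      refine h1.trans_le ?_
      rw [← ENNReal.ofReal_toReal hf.2.ne]
      refine ENNReal.ofReal_le_ofReal ?_
      simp only [A, hA₀]
      linarith
    | succ s ih => exact hxs s ▸ (hnext s (x s) ih).2.2.1
  have hQ := fun s => hnext s (x s) (hP s)
  simp only [← hxs] at hQ
  have hmono : StrictMono fun s => (x s).1 := strictMono_nat_of_lt_succ fun s => (hQ s).1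
  have hstable : ∀ {s t : ℕ}, s ≤ t → ∀ k < (x s).1, (x t).2 k = (x s).2 k := by
    intro s t hst
    induction t, hst using Nat.le_induction with
    | base => exact fun _ _ => rfl
    | succ t hst ih =>
      intro k hk
      rw [(hQ t).2.1 k (hk.trans_le (hmono.monotone hst)), ih k hk]
  -- The number of treated layers grows strictly, so layer `k` is already final at stage `k + 1`.
  let b : ℕ → ℕ → ℂ := fun k => (x (k + 1)).2 k
  have hb : ∀ s, ∀ k < (x s).1, b k = (x s).2 k := by
    intro s k hk
    have hk' : k < (x (k + 1)).1 := hmono.id_le (k + 1)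
    rcases le_total s (k + 1) with h | h
    · exact hstable h k hk
    · exact (hstable h k hk').symm
  refine ⟨b, fun ε hε => ?_⟩
  have hlim : Tendsto (fun s => ENNReal.ofReal (4 * A s)) atTop (𝓝 0) := by
    have h1 : Tendsto (fun s : ℕ => 4 * (((7 : ℝ) / 8) ^ s * A₀)) atTop (𝓝 (4 * (0 * A₀))) :=
      ((tendsto_pow_atTop_nhds_zero_of_lt_one (by norm_num) (by norm_num)).mul_const _).const_mul _
    simpa using ENNReal.tendsto_ofReal h1
  obtain ⟨s₀, hs₀⟩ := eventually_atTop.1 (hlim.eventually_le_const hε)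
  refine ⟨(x s₀).1, fun κ hκ J => ?_⟩
  have hex : ∃ s, κ < (x s).1 := ⟨κ + 1, hmono.id_le (κ + 1)⟩
  classical
  obtain ⟨s, hs, hs'⟩ : ∃ s, (x s).1 ≤ κ ∧ κ < (x (s + 1)).1 := by
    have h1 := Nat.find_spec hex
    rcases Nat.eq_zero_or_pos (Nat.find hex) with h | h
    · rw [h] at h1
      exact absurd h1 (Nat.not_lt_zero κ)
    · refine ⟨Nat.find hex - 1, not_lt.1 (Nat.find_min hex (by omega)), ?_⟩
      rwa [Nat.sub_add_cancel h]
  have hss : s₀ ≤ s := by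
    by_contra! h
    have := hmono.monotone (show s + 1 ≤ s₀ from h)
    exact absurd (hs'.trans_le this) (not_lt.2 hκ)
  refine (hardyNorm_congr p fun z _ => ?_).trans_le (((hQ s).2.2.2 κ hs hs' J).trans (hs₀ s hss))
  rw [layersSum_congr r n fun k hk => hb (s + 1) k (hk.trans hs'), hb (s + 1) κ hs']

theorem exists_eq_layerStart_add {n : ℕ → ℕ} (hn : ∀ k, 1 ≤ n k) (N : ℕ) :
    ∃ κ J, J < n κ ∧ N = layerStart n κ + J := by
  induction N with
  | zero => exact ⟨0, 0, hn 0, by simp [layerStart]⟩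
  | succ N ih =>
    obtain ⟨κ, J, hJ, rfl⟩ := ih
    by_cases h : J + 1 < n κ
    · exact ⟨κ, J + 1, h, by omega⟩
    · refine ⟨κ + 1, 0, hn _, ?_⟩
      rw [layerStart, layerStart, Finset.sum_range_succ]
      omega

theorem sum_range_layerStart_add {n : ℕ → ℕ} (hn : ∀ k, 1 ≤ n k) (F : ℕ → ℕ → ℂ) (κ J : ℕ)
    (hJ : J ≤ n κ) :
    ∑ m ∈ Finset.range (layerStart n κ + J), F (alphaLayer n m) (alphaIndex n m) =
      ∑ k ∈ Finset.range κ, ∑ j ∈ Finset.range (n k), F k j + ∑ j ∈ Finset.range J, F κ j := by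
  have hlayer : ∀ κ J, J ≤ n κ →
      ∑ j ∈ Finset.range J, F (alphaLayer n (layerStart n κ + j))
        (alphaIndex n (layerStart n κ + j)) = ∑ j ∈ Finset.range J, F κ j := fun κ J hJ =>
    Finset.sum_congr rfl fun j hj => by
      obtain ⟨h1, h2⟩ := alpha_layerStart_add n hn κ j ((Finset.mem_range.1 hj).trans_le hJ)
      rw [h1, h2]
  rw [Finset.sum_range_add, hlayer κ J hJ]
  congr 1
  clear hJ
  induction κ with
  | zero => simp [layerStart]
  | succ κ ih =>
    rw [show layerStart n (κ + 1) = layerStart n κ + n κ from Finset.sum_range_succ _ _,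
      Finset.sum_range_add, hlayer κ _ le_rfl, ih, Finset.sum_range_succ]

theorem layerSum_truncCoeff (r : ℕ → ℝ) {n : ℕ → ℕ} {κ J : ℕ} (hJ : J ≤ n κ) (c : ℕ → ℂ) (z : ℂ) :
    layerSum r n κ (truncCoeff J c) z =
      ∑ j ∈ Finset.range J, c j * cauchyKernel (layerPoint r n κ j) z := by
  rw [layerSum, ← Finset.sum_subset (Finset.range_mono hJ) fun j _ hj => ?_]
  · exact Finset.sum_congr rfl fun j hj => by rw [truncCoeff, if_pos (Finset.mem_range.1 hj)]
  · rw [truncCoeff, if_neg fun h => hj (Finset.mem_range.2 h), zero_mul]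

theorem theorem1p1 :
    ∃ M : ℝ, ∀ (r : ℕ → ℝ) (n : ℕ → ℕ),
      (∀ k, 0 ≤ r k ∧ r k < 1) → Tendsto r atTop (𝓝 1) →
      (∀ k, 1 ≤ n k) → (∀ k, M ≤ n k * (1 - r k)) →
      ∀ p : ℝ≥0∞, 1 < p → p < ∞ →
        IsRepresentingHardy p (fun m => cauchyKernel (alphaPoint r n m)) := by
  refine ⟨2, fun r n hr hr1 hn hM p hp1 hp => ⟨fun m => memHardy_cauchyKernel p ?_, ?_⟩⟩
  · exact (norm_layerPoint (fun k => (hr k).1) n _ _).trans_lt (hr _).2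
  intro f hf
  obtain ⟨b, hb⟩ := exists_layer_coefficients hr hr1 hn hM hp1 hp hf
  refine ⟨fun m => b (alphaLayer n m) (alphaIndex n m), ENNReal.tendsto_nhds_zero.2 fun ε hε => ?_⟩
  obtain ⟨K, hK⟩ := hb ε hε
  filter_upwards [eventually_ge_atTop (layerStart n K)] with N hN
  -- The first `N` terms are the complete layers before `κ` and the first `J` kernels of layer `κ`,
  -- possibly none.
  obtain ⟨κ, J, hJ, rfl⟩ := exists_eq_layerStart_add hn N
  have hκ : K ≤ κ := by
    by_contra! h
    have h1 : layerStart n (κ + 1) ≤ layerStart n K :=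
      Finset.sum_le_sum_of_subset (Finset.range_mono h)
    have h2 : layerStart n (κ + 1) = layerStart n κ + n κ := Finset.sum_range_succ _ _
    omega
  refine (hardyNorm_congr p fun z _ => ?_).trans_le (hK κ hκ J)
  have h1 := sum_range_layerStart_add hn
    (fun k j => b k j * cauchyKernel (layerPoint r n k j) z) κ J hJ.le
  simp only [alphaPoint]
  rw [h1, layerSum_truncCoeff r hJ.le]
  rfl
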